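/- Let $F$ be a field of characteristic $0$ and let $n\ge 0$ be an integer. A map $\Phi$ is called multiplicative if $\Phi(AB)=\Phi(A)\Phi(B)$ for all $A,B$. A map $\mathrm{GL}(n,F)\to \mathrm{GL}(n,F)$ or $M_n(F)\to M_n(F)$ is called trivial if it sends every matrix of determinant $1$ to the identity matrix $I_n$, and non-trivial otherwise. A map $\Psi:M_n(F)\to M_n(F)$ is called a degenerate multiplicative map if it is multiplicative and non-trivial, $\Psi(I_n)=I_n$, and $\Psi(A)=0$ for every singular $A$. Say that $\Phi:\mathrm{GL}(n,F)\to \mathrm{GL}(n,F)$ has standard form if $$\Phi(A)=\lambda(\det(\Phi_1(A)))\,\Phi_2(A)\qquad\text{for all }A\in \mathrm{GL}(n,F),$$ where $\lambda:F^*\to F^*$ is multiplicative and each of $\Phi_1,\Phi_2$ is a finite composition of maps $\mathrm{GL}(n,F)\to \mathrm{GL}(n,F)$ of the following kinds: (a) $A\mapsto R^{-1}AR$ for some invertible $n\times n$ matrix $R$ over $F$; (b) $A\mapsto (A^*)^{t}$, where $A^*$ is the adjugate of $A$ (so that $AA^*=\det(A)I_n$) and $t$ denotes transpose; (c) $A=(a_{ij})\mapsto(\varphi(a_{ij}))$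 for some unital ring homomorphism $\varphi:F\to F$. Then: 1. Every non-trivial multiplicative map $\Phi:\mathrm{GL}(n,F)\to \mathrm{GL}(n,F)$ has standard form. 2. Every degenerate multiplicative map $\Psi:M_n(F)\to M_n(F)$ restricts to a non-trivial multiplicative map $\mathrm{GL}(n,F)\to \mathrm{GL}(n,F)$, and this restriction has standard form. 3. Every non-trivial multiplicative map $\Phi:\mathrm{GL}(n,F)\to \mathrm{GL}(n,F)$ is the restriction of exactly one degenerate multiplicative map $\Psi:M_n(F)\to M_n(F)$. -/

import Mathlib

namespace MultMaps

open Matrix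

/-- `Φ` preserves products. -/
def IsMultiplicative {M N : Type*} [Mul M] [Mul N] (Φ : M → N) : Prop :=
  ∀ A B, Φ (A * B) = Φ A * Φ B

variable {n : ℕ} {F : Type*} [Field F]

/-- A map on `GL(n, F)` is trivial if it sends all of `SL(n, F)` to the identity. -/
def IsTrivialGL (Φ : GL (Fin n) F → GL (Fin n) F) : Prop :=
  ∀ A : GL (Fin n) F, (A : Matrix (Fin n) (Fin n) F).det = 1 → Φ A = 1

/-- A map on `M_n(F)` is trivial if it sends all of `SL(n, F)` to the identity. -/
def IsTrivialMat (Ψ : Matrix (Fin n) (Fin n) F → Matrix (Fin n) (Fin n) F) : Prop :=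
  ∀ A : Matrix (Fin n) (Fin n) F, A.det = 1 → Ψ A = 1

/-- A degenerate multiplicative map on `M_n(F)`: unital, multiplicative, non-trivial, and zero on
every singular matrix. -/
structure IsDegenerate (Ψ : Matrix (Fin n) (Fin n) F → Matrix (Fin n) (Fin n) F) : Prop where
  mul : IsMultiplicative Ψ
  one : Ψ 1 = 1
  nontrivial : ¬ IsTrivialMat Ψ
  singular : ∀ A : Matrix (Fin n) (Fin n) F, A.det = 0 → Ψ A = 0

/-- `A ↦ R⁻¹ A R`. -/
def conjMap (R : GL (Fin n) F) : GL (Fin n) F → GL (Fin n) F := fun A => R⁻¹ * A * R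

/-- `A ↦ (A*)ᵗ`, the transpose of the classical adjoint (adjugate) of `A`. -/
noncomputable def adjTransposeMap : GL (Fin n) F → GL (Fin n) F := fun A =>
  Matrix.GeneralLinearGroup.mkOfDetNeZero ((A : Matrix (Fin n) (Fin n) F).adjugateᵀ) (by
    rw [Matrix.det_transpose, Matrix.det_adjugate]
    exact pow_ne_zero _ (Matrix.GeneralLinearGroup.det_ne_zero A))

/-- `(aᵢⱼ) ↦ (φ(aᵢⱼ))`. -/
def entrywiseMap (φ : F →+* F) : GL (Fin n) F → GL (Fin n) F :=
  Matrix.GeneralLinearGroup.map φ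

/-- Finite compositions of the maps `conjMap R`, `adjTransposeMap`, `entrywiseMap φ`. (The identity
is `conjMap 1`.) -/
inductive IsStandardComposition : (GL (Fin n) F → GL (Fin n) F) → Prop
  | conj (R : GL (Fin n) F) : IsStandardComposition (conjMap R)
  | adjTranspose : IsStandardComposition adjTransposeMap
  | entrywise (φ : F →+* F) : IsStandardComposition (entrywiseMap φ)
  | comp {f g : GL (Fin n) F → GL (Fin n) F} :
      IsStandardComposition f → IsStandardComposition g → IsStandardComposition (f ∘ g)

/-- `Φ(A) = lam(det(Φ₁(A))) Φ₂(A)` with `lam` multiplicative on `F*` and `Φ₁`, `Φ₂` compositions of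
the standard maps. -/
def HasStandardForm (Φ : GL (Fin n) F → GL (Fin n) F) : Prop :=
  ∃ (lam : Fˣ →* Fˣ) (Φ₁ Φ₂ : GL (Fin n) F → GL (Fin n) F),
    IsStandardComposition Φ₁ ∧ IsStandardComposition Φ₂ ∧
    ∀ A : GL (Fin n) F,
      (Φ A : Matrix (Fin n) (Fin n) F) =
        ((lam (Matrix.GeneralLinearGroup.det (Φ₁ A)) : Fˣ) : F) •
          (Φ₂ A : Matrix (Fin n) (Fin n) F)

end MultMaps

namespace MultMaps

open Matrix

/-! It suffices to know `Φ` on SL(n, F). If `Φ` agrees there with a standard `Φ₂`, and only scalars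
centralize the image of SL under `Φ₂`, then Φ₂(B)⁻¹Φ(B) is a scalar depending only on det B
(`exists_eq_smul_of_eq_on_sl`).

For n = 2 (`exists_conjHom_eq_map`), conjugation by diag(t, t⁻¹) makes the image of `upper 1`
conjugate to several of its powers, hence unipotent. After a conjugation the upper unipotents
transform by an additive f, and the Weyl element relations make f multiplicative.

For n ≥ 3, the matrices `signGL i` are commuting involutions permuted by the symmetric group. A
joint eigenvector of their images with k minus signs has an orbit containing C(n, k) independent
vectors, so k = 1 or k = n - 1, and the images are, up to one common sign, simultaneously conjugate
to the `signGL i` (`exists_conj_signs`). Centralizers of signs then confine each SL(2) block to its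
own coordinates, where the case n = 2 applies: transvections go to transvections in the same
position or in the transposed one, uniformly in the position. Commutator relations yield one field
endomorphism and constants of the form d_i / d_j (`exists_diag_of_isStraightAt`). The map A ↦ (A*)ᵗ
reduces the transposed case to the straight one.

Degenerate maps correspond to maps on GL by extension by zero, since a product is singular exactly
when a factor is. -/

/-- The homomorphism `A ↦ R ρ(A) R⁻¹`. -/
def conjHom {G ι F : Type*} [Monoid G] [Fintype ι] [DecidableEq ι] [Field F]
    (R : GL ι F) (ρ : G →* Matrix ι ι F) : G →* Matrix ι ι F where
  toFun A := (R : Matrix ι ι F) * ρ A * ((R⁻¹ : GL ι F) : Matrix ι ι F)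
  map_one' := by simp
  map_mul' A B := by
    simp only [map_mul, Matrix.mul_assoc]
    rw [← Matrix.mul_assoc _ (R : Matrix ι ι F), ← Units.val_mul, inv_mul_cancel, Units.val_one,
      Matrix.one_mul]

/-! ### Two-dimensional representations of SL(2, F) -/

section SLTwo

variable {F : Type*} [Field F]

lemma trace_eq_of_conj {ι : Type*} [Fintype ι] [DecidableEq ι] {u v x y : Matrix ι ι F}
    (h : x * u = v * x) (hx : y * x = 1) : u.trace = v.trace := by
  have hx' : x * y = 1 := mul_eq_one_comm.mp hx
  calc u.trace = (y * (x * u)).trace := by rw [← Matrix.mul_assoc, hx, Matrix.one_mul]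
    _ = (v * (x * y)).trace := by rw [h, Matrix.trace_mul_comm, Matrix.mul_assoc]
    _ = v.trace := by rw [hx', Matrix.mul_one]

lemma eq_one_of_conj_one {ι : Type*} [Fintype ι] [DecidableEq ι] {u x y : Matrix ι ι F}
    (h : x * u = x) (hx : y * x = 1) : u = 1 := by
  calc u = y * (x * u) := by rw [← Matrix.mul_assoc, hx, Matrix.one_mul]
    _ = 1 := by rw [h, hx]

/-- A `2 × 2` matrix of determinant one that is conjugate to its powers with exponents
`4`, `9`, `25` is unipotent. -/
lemma trace_eq_two_of_conj_pow [CharZero F] {u x x' y y' z z' : Matrix (Fin 2) (Fin 2) F} (hdet : u.det = 1)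
    (hx : x * u = u ^ 4 * x) (hx' : x' * x = 1) (hy : y * u = u ^ 9 * y) (hy' : y' * y = 1)
    (hz : z * u = u ^ 25 * z) (hz' : z' * z = 1) : u.trace = 2 := by
  set τ := u.trace with hτ
  have hsq : u ^ 2 = τ • u - 1 := by
    rw [det_fin_two] at hdet
    ext i j
    fin_cases i <;> fin_cases j <;>
      simp [hτ, pow_two, Matrix.mul_apply, Fin.sum_univ_two, Matrix.trace] <;> grind
  have h4 : u ^ 4 = (τ ^ 3 - 2 * τ) • u + (1 - τ ^ 2) • (1 : Matrix (Fin 2) (Fin 2) F) := by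
    have : u ^ 4 = (τ * τ) • u ^ 2 - (2 * τ) • u + 1 := by
      have : u ^ 4 = (τ • u - 1) * (τ • u - 1) := by rw [← hsq, ← pow_add]
      rw [this]
      simp only [pow_two, sub_mul, mul_sub, smul_mul_assoc, mul_smul_comm, mul_one, one_mul]
      module
    rw [this, hsq]
    module
  have htr := trace_eq_of_conj hx hx'
  rw [h4, Matrix.trace_add, Matrix.trace_smul, Matrix.trace_smul, Matrix.trace_one, ← hτ] at htr
  simp only [smul_eq_mul, Fintype.card_fin, Nat.cast_ofNat] at htr
  -- The equation tr u⁴ = tr u reads τ⁴ - 4τ² + 2 = τ. A root other than 2 gives u³ = 1 or u⁵ = 1,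
  -- and then u is conjugate to u⁹ = 1 or u²⁵ = 1.
  have hfac : (τ - 2) * ((τ + 1) * (τ ^ 2 + τ - 1)) = 0 := by linear_combination -htr
  rcases mul_eq_zero.mp hfac with h | h
  · linear_combination h
  have hone : u = 1 → τ = 2 := by
    rintro h
    simp [hτ, h]
  rcases mul_eq_zero.mp h with h | h
  · have h3 : u ^ 3 = 1 := by
      have ht : τ = -1 := by linear_combination h
      rw [pow_succ, hsq, ht, sub_mul, smul_mul_assoc, ← pow_two, hsq, ht]
      simp
    refine hone (eq_one_of_conj_one (y := y') ?_ hy')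
    rw [hy, show (9 : ℕ) = 3 * 3 from rfl, pow_mul, h3, one_pow, one_mul]
  · have h5 : u ^ 5 = 1 := by
      rw [pow_succ, h4, add_mul, smul_mul_assoc, ← pow_two, hsq]
      have e1 : τ ^ 3 - 2 * τ = -1 := by linear_combination (τ - 1) * h
      have e2 : τ ^ 2 = 1 - τ := by linear_combination h
      rw [e1, e2, smul_mul_assoc, one_mul]
      module
    refine hone (eq_one_of_conj_one (y := z') ?_ hz')
    rw [hz, show (25 : ℕ) = 5 * 5 from rfl, pow_mul, h5, one_pow, one_mul]

/-- A nontrivial unipotent `2 × 2` matrix is conjugate to the standard one. -/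
lemma exists_conj_transvection {u : Matrix (Fin 2) (Fin 2) F} (hdet : u.det = 1)
    (htr : u.trace = 2) (hu : u ≠ 1) :
    ∃ R : GL (Fin 2) F, (R : Matrix (Fin 2) (Fin 2) F) * u * ((R⁻¹ : GL (Fin 2) F) : Matrix (Fin 2) (Fin 2) F)
      = !![1, 1; 0, 1] := by
  have key : ∀ Q : GL (Fin 2) F, u * (Q : Matrix (Fin 2) (Fin 2) F) =
      (Q : Matrix (Fin 2) (Fin 2) F) * !![1, 1; 0, 1] →
      ∃ R : GL (Fin 2) F, (R : Matrix (Fin 2) (Fin 2) F) * u *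
        ((R⁻¹ : GL (Fin 2) F) : Matrix (Fin 2) (Fin 2) F) = !![1, 1; 0, 1] := by
    intro Q hQ
    refine ⟨Q⁻¹, ?_⟩
    rw [inv_inv, Matrix.mul_assoc, hQ, ← Matrix.mul_assoc, ← Units.val_mul, inv_mul_cancel,
      Units.val_one, Matrix.one_mul]
  rw [det_fin_two] at hdet
  rw [Matrix.trace_fin_two] at htr
  -- The conjugating matrix has columns (u - 1)v and v, a Jordan basis, with v the second basis
  -- vector if u is upper triangular and the first otherwise.
  by_cases hc : u 1 0 = 0
  · have ha : u 0 0 = 1 := by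
      rw [hc, mul_zero, sub_zero] at hdet
      have : (u 0 0 - 1) ^ 2 = 0 := by linear_combination u 0 0 * htr - hdet
      linear_combination pow_eq_zero_iff two_ne_zero |>.mp this
    have hd : u 1 1 = 1 := by linear_combination htr - ha
    have hb : u 0 1 ≠ 0 := by
      intro hb
      apply hu
      ext i j
      fin_cases i <;> fin_cases j <;> simp [*]
    refine key (GeneralLinearGroup.mkOfDetNeZero !![u 0 1, 0; 0, 1] (by simpa)) ?_
    ext i j
    fin_cases i <;> fin_cases j <;>
      simp [GeneralLinearGroup.mkOfDetNeZero, Matrix.mul_apply, Fin.sum_univ_two, *]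
  · refine key (GeneralLinearGroup.mkOfDetNeZero !![u 0 0 - 1, 1; u 1 0, 0] (by simpa)) ?_
    ext i j
    fin_cases i <;> fin_cases j <;>
      simp [GeneralLinearGroup.mkOfDetNeZero, Matrix.mul_apply, Fin.sum_univ_two] <;> grind

/-- SL(2, F) is perfect, the scalar 2 serving as witness. -/
lemma monoidHom_sl_two_eq_one [CharZero F] {M : Type*} [CommMonoid M]
    (χ : SpecialLinearGroup (Fin 2) F →* M) (A : SpecialLinearGroup (Fin 2) F) : χ A = 1 := by
  have h : commutator (SpecialLinearGroup (Fin 2) F) ≤ χ.toHomUnits.ker :=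
    Abelianization.commutator_subset_ker _
  rw [SL2.commutator_eq_top (a := (2 : F)) two_ne_zero (by norm_num)] at h
  have := h (Subgroup.mem_top A)
  rw [MonoidHom.mem_ker] at this
  simpa using congrArg Units.val this

/-- The unit upper triangular matrix with entry `t`, in `SL(2, F)`. -/
abbrev upper (t : F) : SpecialLinearGroup (Fin 2) F := SpecialLinearGroup.transvection zero_ne_one t

/-- The unit lower triangular matrix with entry `t`, in `SL(2, F)`. -/
abbrev lower (t : F) : SpecialLinearGroup (Fin 2) F := SpecialLinearGroup.transvection one_ne_zero t

lemma coe_upper (t : F) : (upper t : Matrix (Fin 2) (Fin 2) F) = !![1, t; 0, 1] := by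
  ext i j
  fin_cases i <;> fin_cases j <;> simp [SpecialLinearGroup.transvection_coe]

lemma coe_lower (t : F) : (lower t : Matrix (Fin 2) (Fin 2) F) = !![1, 0; t, 1] := by
  ext i j
  fin_cases i <;> fin_cases j <;> simp [SpecialLinearGroup.transvection_coe]

lemma sl_ext {ι : Type*} [Fintype ι] [DecidableEq ι] {A B : SpecialLinearGroup ι F}
    (h : (A : Matrix ι ι F) = (B : Matrix ι ι F)) : A = B :=
  Subtype.ext h

/-- The Weyl element of `SL(2, F)` with parameter `t`. -/
noncomputable def weyl (t : F) : SpecialLinearGroup (Fin 2) F :=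
  upper t * lower (-t⁻¹) * upper t

lemma coe_weyl {t : F} (ht : t ≠ 0) :
    (weyl t : Matrix (Fin 2) (Fin 2) F) = !![0, t; -t⁻¹, 0] := by
  simp [weyl, coe_upper, coe_lower, ht]

/-- Weyl elements exchange the two root subgroups, so what is known about upper unipotents transfers
to lower ones. -/
lemma weyl_mul_upper {t : F} (ht : t ≠ 0) (s : F) :
    weyl t * upper s = lower (-s / t ^ 2) * weyl t := by
  apply sl_ext
  simp only [Matrix.SpecialLinearGroup.coe_mul, coe_weyl ht, coe_upper, coe_lower]
  ext i j
  fin_cases i <;> fin_cases j <;> simp [field]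

/-- For t = 2, 3, 5 and s = 1 this conjugates `upper 1` to its powers with exponents 4, 9, 25. -/
lemma diag2_mul_upper {t : F} (ht : t ≠ 0) (s : F) :
    SpecialLinearGroup.diag2 t ht * upper s =
      upper (t ^ 2 * s) * SpecialLinearGroup.diag2 t ht := by
  apply sl_ext
  simp only [Matrix.SpecialLinearGroup.coe_mul, SpecialLinearGroup.diag2_coe', coe_upper]
  ext i j
  fin_cases i <;> fin_cases j <;> simp [field]

lemma diag2_eq_weyl {t : F} (ht : t ≠ 0) :
    SpecialLinearGroup.diag2 t ht = weyl t * (weyl 1)⁻¹ := by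
  rw [eq_mul_inv_iff_mul_eq]
  apply sl_ext
  simp only [Matrix.SpecialLinearGroup.coe_mul, SpecialLinearGroup.diag2_coe', coe_weyl ht,
    coe_weyl one_ne_zero]
  ext i j
  fin_cases i <;> fin_cases j <;> simp

lemma upper_natCast (k : ℕ) : upper (k : F) = upper 1 ^ k := by
  induction k with
  | zero => simp
  | succ k ih => rw [Nat.cast_succ, upper, SpecialLinearGroup.transvection_add, pow_succ, ← ih]


lemma conjHom_conjHom {G ι : Type*} [Monoid G] [Fintype ι] [DecidableEq ι]
    (R S : GL ι F) (ρ : G →* Matrix ι ι F) : conjHom R (conjHom S ρ) = conjHom (R * S) ρ := by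
  ext1 A
  simp [conjHom, Matrix.mul_assoc]

variable [CharZero F]

lemma det_apply_eq_one (ρ : SpecialLinearGroup (Fin 2) F →* Matrix (Fin 2) (Fin 2) F)
    (A : SpecialLinearGroup (Fin 2) F) : (ρ A).det = 1 :=
  monoidHom_sl_two_eq_one (Matrix.detMonoidHom.comp ρ) A

lemma exists_conjHom_upper (ρ : SpecialLinearGroup (Fin 2) F →* Matrix (Fin 2) (Fin 2) F)
    (h : ρ (upper 1) ≠ 1) :
    ∃ R : GL (Fin 2) F, conjHom R ρ (upper 1) = !![1, 1; 0, 1] := by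
  have hinv (A : SpecialLinearGroup (Fin 2) F) : ρ A⁻¹ * ρ A = 1 := by
    rw [← map_mul, inv_mul_cancel, map_one]
  have hconj (t : ℕ) (ht : (t : F) ≠ 0) :
      ρ (SpecialLinearGroup.diag2 (t : F) ht) * ρ (upper 1) =
        ρ (upper 1) ^ (t ^ 2) * ρ (SpecialLinearGroup.diag2 (t : F) ht) := by
    rw [← map_mul, diag2_mul_upper, ← map_pow, ← upper_natCast, ← map_mul]
    push_cast
    rw [mul_one]
  refine exists_conj_transvection (det_apply_eq_one ρ _) ?_ h
  exact trace_eq_two_of_conj_pow (det_apply_eq_one ρ _)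
    (hconj 2 (by norm_num)) (hinv _) (hconj 3 (by norm_num)) (hinv _)
    (hconj 5 (by norm_num)) (hinv _)

/-- If the image of `upper 1` is standard, then so is the image of every `upper t`, up to an
additive function of the parameter. -/
lemma exists_addHom_upper (ρ : SpecialLinearGroup (Fin 2) F →* Matrix (Fin 2) (Fin 2) F)
    (h : ρ (upper 1) = !![1, 1; 0, 1]) :
    ∃ f : F →+ F, f 1 = 1 ∧ ∀ t, ρ (upper t) = !![1, f t; 0, 1] := by
  have hform (t : F) : ρ (upper t) 1 0 = 0 ∧ ρ (upper t) 0 0 = ρ (upper t) 1 1 := by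
    have : ρ (upper t) * ρ (upper 1) = ρ (upper 1) * ρ (upper t) := by
      rw [← map_mul, ← map_mul, ← SpecialLinearGroup.transvection_add, add_comm,
        SpecialLinearGroup.transvection_add]
    rw [h] at this
    have h00 := congrFun (congrFun this 0) 0
    have h01 := congrFun (congrFun this 0) 1
    simp [Matrix.mul_apply, Fin.sum_univ_two] at h00 h01
    exact ⟨h00, by linear_combination h01⟩
  have hsq (t : F) : ρ (upper t) 0 0 ^ 2 = 1 := by
    have := det_apply_eq_one ρ (upper t)
    rw [det_fin_two, (hform t).1, ← (hform t).2] at this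
    linear_combination this
  have hadd (s t : F) : ρ (upper (s + t)) = ρ (upper s) * ρ (upper t) := by
    rw [upper, SpecialLinearGroup.transvection_add, map_mul]
  -- The diagonal entry at t is the square of the one at t / 2, which rules out the sign -1.
  have hone (t : F) : ρ (upper t) 0 0 = 1 := by
    have h2 := congrFun (congrFun (hadd (t / 2) (t / 2)) 0) 0
    rw [add_halves, Matrix.mul_apply, Fin.sum_univ_two, (hform _).1] at h2
    rw [h2]
    linear_combination hsq (t / 2)
  have hval (t : F) : ρ (upper t) = !![1, ρ (upper t) 0 1; 0, 1] := by
    ext i j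
    fin_cases i <;> fin_cases j
    · exact hone t
    · rfl
    · exact (hform t).1
    · exact (hform t).2 ▸ hone t
  refine ⟨AddMonoidHom.mk' (fun t => ρ (upper t) 0 1) fun s t => ?_, by simp [h], hval⟩
  rw [hadd, hval s, hval t]
  simp [Matrix.mul_apply, Fin.sum_univ_two, add_comm]

/-- If the images of `upper 1` and `weyl 1` are standard up to an antidiagonal, the homomorphism is
given by an endomorphism of the field. -/
lemma exists_ringHom_of_weyl (ρ : SpecialLinearGroup (Fin 2) F →* Matrix (Fin 2) (Fin 2) F)
    (f : F →+ F) (hf : f 1 = 1) (hU : ∀ t, ρ (upper t) = !![1, f t; 0, 1])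
    (h0 : ρ (weyl 1) 0 0 = 0) (h1 : ρ (weyl 1) 1 1 = 0) :
    ∃ φ : F →+* F, ∀ A, ρ A = (A : Matrix (Fin 2) (Fin 2) F).map φ := by
  obtain ⟨q, r, hW⟩ : ∃ q r, ρ (weyl 1) = !![0, q; r, 0] :=
    ⟨_, _, by rw [← h0]; nth_rewrite 2 [h0]; rw [← h1]; exact eta_fin_two _⟩
  have hqr : q * r = -1 := by
    have := det_apply_eq_one ρ (weyl 1)
    rw [hW, det_fin_two] at this
    simp at this
    linear_combination -this
  have hr : r ≠ 0 := by rintro rfl; simp at hqr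
  have hV' (t : F) : ρ (lower t) = !![1, 0; r ^ 2 * f t, 1] := by
    have h2 := congrArg ρ (weyl_mul_upper one_ne_zero (-t))
    rw [map_mul, map_mul, hU, hW] at h2
    rw [show - -t / 1 ^ 2 = t by simp] at h2
    have h00 := congrFun (congrFun h2 0) 0
    have h01 := congrFun (congrFun h2 0) 1
    have h10 := congrFun (congrFun h2 1) 0
    have h11 := congrFun (congrFun h2 1) 1
    simp [Matrix.mul_apply, Fin.sum_univ_two] at h00 h01 h10 h11
    have hq : q ≠ 0 := by rintro rfl; simp at hqr
    ext i j
    fin_cases i <;> fin_cases j <;> simp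
    · grind
    · grind
    · apply mul_right_cancel₀ hq
      linear_combination -h11 - r * f t * hqr
    · grind
  -- The (0, 0) entry of the defining product of `weyl 1` is 1 - r², and it must vanish.
  have hr2 : r ^ 2 = 1 := by
    have h2 : ρ (weyl 1) = ρ (upper 1) * ρ (lower (-1)) * ρ (upper 1) := by
      rw [← map_mul, ← map_mul, weyl, inv_one]
    rw [hV', hU, hW] at h2
    have h00 := congrFun (congrFun h2 0) 0
    simp [hf] at h00
    linear_combination h00
  have hV (t : F) : ρ (lower t) = !![1, 0; f t, 1] := by rw [hV', hr2, one_mul]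
  have hw1 : ρ (weyl 1) = !![0, 1; -1, 0] := by
    simp [weyl, map_mul, hU, hV, hf]
  have hinv {t : F} (ht : t ≠ 0) : f t * f t⁻¹ = 1 ∧ ρ (weyl t) = !![0, f t; -f t⁻¹, 0] := by
    have hwt : ρ (weyl t) = !![1 - f t * f t⁻¹, (1 - f t * f t⁻¹) * f t + f t;
        -f t⁻¹, 1 - f t * f t⁻¹] := by
      simp only [weyl, map_mul, hU, hV, map_neg]
      ext i j
      fin_cases i <;> fin_cases j <;> simp [-mul_eq_mul_right_iff] <;> ring
    -- The (0, 1) entry of this relation says that the (0, 0) entry of the image of `weyl t` is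
    -- zero, that is, f(t) f(t⁻¹) = 1.
    have h2 := congrArg ρ (weyl_mul_upper ht 1)
    rw [map_mul, map_mul, hV, hU, hwt, hf] at h2
    have h01 := congrFun (congrFun h2 0) 1
    simp [Matrix.mul_apply, Fin.sum_univ_two] at h01
    refine ⟨by linear_combination -h01, ?_⟩
    rw [hwt, h01, zero_mul, zero_add]
  have hdiag {t : F} (ht : t ≠ 0) : ρ (SpecialLinearGroup.diag2 t ht) 0 0 = f t ∧
      ρ (SpecialLinearGroup.diag2 t ht) 0 1 = 0 := by
    have h2 : ρ (SpecialLinearGroup.diag2 t ht) * ρ (weyl 1) = ρ (weyl t) := by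
      rw [diag2_eq_weyl, ← map_mul, inv_mul_cancel_right]
    rw [hw1, (hinv ht).2] at h2
    have h00 := congrFun (congrFun h2 0) 0
    have h01 := congrFun (congrFun h2 0) 1
    simp [Matrix.mul_apply, Fin.sum_univ_two] at h00 h01
    exact ⟨h01, h00⟩
  -- Multiplicativity of t ↦ diag(t, t⁻¹) passes to f, which is the (0, 0) entry of the image.
  have hmul (s t : F) : f (s * t) = f s * f t := by
    by_cases hs : s = 0
    · simp [hs]
    by_cases ht : t = 0
    · simp [ht]
    have h2 : SpecialLinearGroup.diag2 (s * t) (mul_ne_zero hs ht) =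
        SpecialLinearGroup.diag2 s hs * SpecialLinearGroup.diag2 t ht := by
      apply sl_ext
      simp only [Matrix.SpecialLinearGroup.coe_mul, SpecialLinearGroup.diag2_coe']
      ext i j
      fin_cases i <;> fin_cases j <;> simp [mul_comm]
    rw [← (hdiag (mul_ne_zero hs ht)).1, h2, map_mul, Matrix.mul_apply, Fin.sum_univ_two,
      (hdiag hs).1, (hdiag hs).2, (hdiag ht).1, zero_mul, add_zero]
  refine ⟨{ f with map_one' := hf, map_mul' := hmul }, fun A => ?_⟩
  refine SL2.transvection_induction (fun A => ρ A = (A : Matrix (Fin 2) (Fin 2) F).map f)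
    (fun i j hij c => ?_) (fun A B hA hB => ?_) A
  · have hc : (i = 0 ∧ j = 1) ∨ (i = 1 ∧ j = 0) := by omega
    rcases hc with ⟨rfl, rfl⟩ | ⟨rfl, rfl⟩
    · refine (hU c).trans ?_
      ext i j
      fin_cases i <;> fin_cases j <;> simp [SpecialLinearGroup.transvection_coe, hf]
    · refine (hV c).trans ?_
      ext i j
      fin_cases i <;> fin_cases j <;> simp [SpecialLinearGroup.transvection_coe, hf]
  · rw [map_mul, hA, hB, Matrix.SpecialLinearGroup.coe_mul]
    ext i j
    simp [Matrix.mul_apply, hmul]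

/-- A homomorphism `SL(2, F) → M₂(F)` that does not kill `upper 1` is, up to conjugation, given by
an endomorphism of the field. -/
theorem exists_conjHom_eq_map (ρ : SpecialLinearGroup (Fin 2) F →* Matrix (Fin 2) (Fin 2) F)
    (h : ρ (upper 1) ≠ 1) :
    ∃ (R : GL (Fin 2) F) (φ : F →+* F), ∀ A,
      conjHom R ρ A = (A : Matrix (Fin 2) (Fin 2) F).map φ := by
  obtain ⟨R, hR⟩ := exists_conjHom_upper ρ h
  set σ := conjHom R ρ with hσ
  obtain ⟨f, hf, hU⟩ := exists_addHom_upper σ hR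
  obtain ⟨a, b, c, d, hW⟩ : ∃ a b c d, σ (weyl 1) = !![a, b; c, d] :=
    ⟨_, _, _, _, eta_fin_two _⟩
  have hdet := det_apply_eq_one σ (weyl 1)
  rw [hW, det_fin_two] at hdet
  simp at hdet
  -- If c = 0, both root subgroups map into the upper unitriangular matrices, which commute. Since
  -- `weyl 2` conjugates `upper 4` to `lower (-1)`, this would give 4 = f 4 = f 1 = 1.
  have hc : c ≠ 0 := by
    rintro rfl
    have hWi : !![a, b; 0, d] * !![d, -b; 0, a] = (1 : Matrix (Fin 2) (Fin 2) F) := by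
      ext i j
      fin_cases i <;> fin_cases j <;> simp <;> grind
    have hV (s : F) : σ (lower (-s)) = !![a, b; 0, d] * !![1, f s; 0, 1] * !![d, -b; 0, a] := by
      rw [← hU s, ← hW, ← map_mul, weyl_mul_upper one_ne_zero, map_mul, one_pow, div_one, hW,
        Matrix.mul_assoc, hWi, Matrix.mul_one]
    have hweyl : σ (weyl 1) = σ (upper 1) * σ (lower (-1)) * σ (upper 1) := by
      rw [weyl, map_mul, map_mul, inv_one]
    have hp : a = 1 := by
      rw [hV, hU, hW] at hweyl
      have h2 := congrFun (congrFun hweyl 0) 0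
      simp at h2
      linear_combination h2 + hdet
    have hs : d = 1 := by
      rw [hp] at hdet
      linear_combination hdet
    have hV' (s : F) : σ (lower (-s)) = !![1, f s; 0, 1] := by
      rw [hV, hs, hp]
      ext i j
      fin_cases i <;> fin_cases j <;> simp
    have hw2 : σ (weyl 2) = !![1, f 2 + (f 2⁻¹ + f 2); 0, 1] := by
      rw [weyl, map_mul, map_mul, hV', hU]
      ext i j
      fin_cases i <;> fin_cases j <;> simp [add_comm]
    have h4 : σ (weyl 2) * σ (upper 4) = σ (lower (-1)) * σ (weyl 2) := by
      rw [← map_mul, weyl_mul_upper two_ne_zero, map_mul]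
      norm_num
    have h01 := congrFun (congrFun h4 0) 1
    rw [hw2, hV', hU, hf] at h01
    have hf4 : f 4 = 4 := by
      rw [show (4 : F) = 1 + 1 + 1 + 1 by norm_num]
      simp only [map_add, hf]
    simp [hf4] at h01
    have : (3 : F) = 0 := by linear_combination h01
    norm_num at this
  -- The square of `weyl 1` is central, so the square of its image commutes with the Jordan block;
  -- hence its (1, 0) entry c(a + d) is zero.
  have htr : a + d = 0 := by
    have h2 : weyl (1 : F) * weyl 1 * upper 1 = upper 1 * (weyl 1 * weyl 1) := by
      apply sl_ext
      simp only [Matrix.SpecialLinearGroup.coe_mul, coe_weyl one_ne_zero, coe_upper]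
      ext i j
      fin_cases i <;> fin_cases j <;> simp
    have h3 := congrArg σ h2
    simp only [map_mul, hW, hR] at h3
    have h00 := congrFun (congrFun h3 0) 0
    simp at h00
    grind
  -- `Q` commutes with the images of the upper unipotents, and conjugation by it clears the diagonal
  -- of the image of `weyl 1`.
  let Q : GL (Fin 2) F := GeneralLinearGroup.mkOfDetNeZero !![1, -a / c; 0, 1] (by simp)
  have hQ' : (Q : Matrix (Fin 2) (Fin 2) F) = !![1, -a / c; 0, 1] := rfl
  have hQ : ((Q⁻¹ : GL (Fin 2) F) : Matrix (Fin 2) (Fin 2) F) = !![1, a / c; 0, 1] := by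
    rw [Matrix.coe_units_inv]
    refine Matrix.inv_eq_right_inv ?_
    ext i j
    fin_cases i <;> fin_cases j <;> simp [hQ']
    ring
  obtain ⟨φ, hφ⟩ := exists_ringHom_of_weyl (conjHom Q σ) f hf
    (fun t => by simp [conjHom, hQ, hQ', hU]; ring)
    (by simp [conjHom, hQ, hQ', hW]; field_simp; ring)
    (by simp [conjHom, hQ, hQ', hW]; field_simp; linear_combination htr)
  exact ⟨Q * R, φ, fun A => by rw [← hφ, hσ, conjHom_conjHom]⟩

end SLTwo

/-! ### SL(2) blocks inside SL(n) and generation by transvections -/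

section Block

variable {ι : Type*} [DecidableEq ι] {F : Type*} [Field F]

/-- The matrix whose two columns are the basis vectors indexed by `i` and `j`. -/
def pairMatrix (F : Type*) [Field F] (i j : ι) : Matrix ι (Fin 2) F :=
  of fun k a => if k = ![i, j] a then 1 else 0

lemma pairMatrix_apply (i j k : ι) (a : Fin 2) :
    pairMatrix F i j k a = if k = ![i, j] a then 1 else 0 := rfl

variable [Fintype ι]

lemma pairMatrix_transpose_mul {i j : ι} (h : i ≠ j) :
    (pairMatrix F i j)ᵀ * pairMatrix F i j = 1 := by
  ext a b
  simp only [Matrix.mul_apply, Matrix.transpose_apply, pairMatrix_apply, mul_ite, mul_one, mul_zero,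
    Finset.sum_ite_eq', Finset.mem_univ, if_true]
  fin_cases a <;> fin_cases b <;> simp [h, h.symm]

/-- The embedding of `SL(2, F)` on the coordinates `i` and `j`. -/
def blockHom {i j : ι} (h : i ≠ j) :
    SpecialLinearGroup (Fin 2) F →* SpecialLinearGroup ι F where
  toFun A := ⟨1 + pairMatrix F i j * ((A : Matrix (Fin 2) (Fin 2) F) - 1) * (pairMatrix F i j)ᵀ, by
    rw [Matrix.mul_assoc, Matrix.det_one_add_mul_comm, Matrix.mul_assoc,
      pairMatrix_transpose_mul h, Matrix.mul_one, add_sub_cancel, A.det_coe]⟩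
  map_one' := sl_ext (by simp)
  map_mul' A B := sl_ext (by
    have key : ∀ (J : Matrix ι (Fin 2) F) (K : Matrix (Fin 2) ι F) (X Y : Matrix (Fin 2) (Fin 2) F),
        K * J = 1 → 1 + J * (X * Y - 1) * K = (1 + J * (X - 1) * K) * (1 + J * (Y - 1) * K) := by
      intro J K X Y hJ
      have : J * (X - 1) * K * (J * (Y - 1) * K) = J * ((X - 1) * (Y - 1)) * K := by
        calc _ = J * (X - 1) * (K * J) * (Y - 1) * K := by simp only [Matrix.mul_assoc]
          _ = _ := by rw [hJ, Matrix.mul_one]; simp only [Matrix.mul_assoc]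
      rw [mul_add, add_mul, add_mul, this]
      simp only [mul_one, one_mul, sub_mul, mul_sub, Matrix.mul_sub, Matrix.sub_mul]
      abel
    exact key _ _ _ _ (pairMatrix_transpose_mul h))

lemma coe_blockHom {i j : ι} (h : i ≠ j) (A : SpecialLinearGroup (Fin 2) F) :
    (blockHom h A : Matrix ι ι F) =
      1 + pairMatrix F i j * ((A : Matrix (Fin 2) (Fin 2) F) - 1) * (pairMatrix F i j)ᵀ := rfl

lemma blockHom_apply {i j : ι} (h : i ≠ j) (A : SpecialLinearGroup (Fin 2) F) (k l : ι) :
    (blockHom h A : Matrix ι ι F) k l = (1 : Matrix ι ι F) k l +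
      ((if k = i then (if l = i then A 0 0 - 1 else if l = j then A 0 1 else 0) else
      if k = j then (if l = i then A 1 0 else if l = j then A 1 1 - 1 else 0) else 0)) := by
  rw [coe_blockHom, Matrix.add_apply]
  congr 1
  simp only [Matrix.mul_apply, Fin.sum_univ_two, Matrix.transpose_apply, pairMatrix_apply,
    Matrix.sub_apply, Matrix.one_apply]
  by_cases hk : k = i <;> by_cases hl : l = i <;> by_cases hk' : k = j <;>
    by_cases hl' : l = j <;> simp_all

lemma blockHom_upper {i j : ι} (h : i ≠ j) (t : F) :
    blockHom h (upper t) = SpecialLinearGroup.transvection h t := by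
  apply sl_ext
  ext k l
  rw [blockHom_apply, coe_upper, SpecialLinearGroup.transvection_coe, Matrix.add_apply,
    Matrix.single_apply]
  simp
  grind

lemma blockHom_lower {i j : ι} (h : i ≠ j) (t : F) :
    blockHom h (lower t) = SpecialLinearGroup.transvection h.symm t := by
  apply sl_ext
  ext k l
  rw [blockHom_apply, coe_lower, SpecialLinearGroup.transvection_coe, Matrix.add_apply,
    Matrix.single_apply]
  simp
  grind

lemma blockHom_diag2 {i j : ι} (h : i ≠ j) {c : F} (hc : c ≠ 0) :
    blockHom h (SpecialLinearGroup.diag2 c hc) = SpecialLinearGroup.diag2n h c hc := by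
  apply sl_ext
  ext k l
  rw [blockHom_apply, SpecialLinearGroup.diag2_coe', SpecialLinearGroup.diag2n_coe,
    Matrix.diagonal_apply, Matrix.one_apply]
  simp
  grind

lemma eq_of_eq_upper_lower {M : Type*} [Monoid M] {f g : SpecialLinearGroup (Fin 2) F →* M}
    (hu : ∀ t, f (upper t) = g (upper t)) (hl : ∀ t, f (lower t) = g (lower t)) : f = g := by
  ext1 A
  refine SL2.transvection_induction (fun A => f A = g A) (fun i j hij c => ?_)
    (fun A B hA hB => by rw [map_mul, map_mul, hA, hB]) A
  have hc : (i = 0 ∧ j = 1) ∨ (i = 1 ∧ j = 0) := by omega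
  rcases hc with ⟨rfl, rfl⟩ | ⟨rfl, rfl⟩
  · exact hu c
  · exact hl c

/-- Homomorphisms on `SL(n, F)` that agree on transvections are equal. -/
lemma eq_of_eq_transvection [Nontrivial ι] {M : Type*} [Monoid M]
    {f g : SpecialLinearGroup ι F →* M}
    (h : ∀ (i j : ι) (hij : i ≠ j) (t : F), f (SpecialLinearGroup.transvection hij t) =
      g (SpecialLinearGroup.transvection hij t)) : f = g := by
  ext1 A
  refine SpecialLinearGroup.diagonal_transvection_induction' (fun A => f A = g A) A
    (fun i j hij c hc => ?_) h (fun A B hA hB => by rw [map_mul, map_mul, hA, hB])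
  -- The diagonal generator lies in an SL(2) block, which transvections generate.
  have : f.comp (blockHom hij) = g.comp (blockHom hij) := by
    refine eq_of_eq_upper_lower (fun t => ?_) (fun t => ?_)
    · simp only [MonoidHom.comp_apply, blockHom_upper, h]
    · simp only [MonoidHom.comp_apply, blockHom_lower, h]
  simpa only [MonoidHom.comp_apply, blockHom_diag2] using
    DFunLike.congr_fun this (SpecialLinearGroup.diag2 c hc)

end Block

/-! ### From SL(n) to GL(n) -/

section Extension

variable {ι : Type*} [Fintype ι] [DecidableEq ι] {F : Type*} [Field F]

/-- Invertible diagonal matrices. -/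
def diagGL : (ι → Fˣ) →* GL ι F where
  toFun d := ⟨diagonal fun i => (d i : F), diagonal fun i => ((d i)⁻¹ : Fˣ), by simp, by simp⟩
  map_one' := by ext; simp
  map_mul' d e := Units.ext (by simp [Matrix.diagonal_mul_diagonal])

lemma coe_diagGL (d : ι → Fˣ) :
    (diagGL d : Matrix ι ι F) = diagonal fun i => (d i : F) := rfl

lemma det_diagGL_mulSingle (i : ι) (x : Fˣ) :
    GeneralLinearGroup.det (diagGL (Pi.mulSingle i x) : GL ι F) = x := by
  ext
  simp [coe_diagGL, ← Units.coe_prod]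

/-- Two homomorphisms on `GL(n, F)` that agree on `SL(n, F)` differ by a power of the determinant,
provided the centralizer of the image of `SL(n, F)` consists of scalars. -/
theorem exists_eq_smul_of_eq_on_sl [Nonempty ι] (Φ Φ₂ : GL ι F →* GL ι F)
    (h : ∀ A : SpecialLinearGroup ι F, Φ (A : GL ι F) = Φ₂ (A : GL ι F))
    (hcent : ∀ M : GL ι F, (∀ A : SpecialLinearGroup ι F, Commute M (Φ₂ (A : GL ι F))) →
      M ∈ Subgroup.center (GL ι F)) :
    ∃ lam : Fˣ →* Fˣ, ∀ A : GL ι F, (Φ A : Matrix ι ι F) =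
      ((lam (GeneralLinearGroup.det A) : Fˣ) : F) • (Φ₂ A : Matrix ι ι F) := by
  obtain ⟨i₀⟩ := ‹Nonempty ι›
  -- A section of the determinant: each A is s(det A) times an element of SL.
  let s : Fˣ →* GL ι F := diagGL.comp (MonoidHom.mulSingle (fun _ => Fˣ) i₀)
  have hs (x : Fˣ) : GeneralLinearGroup.det (s x) = x := det_diagGL_mulSingle i₀ x
  have hz (B : GL ι F) : (Φ₂ B)⁻¹ * Φ B ∈ Subgroup.center (GL ι F) := by
    refine hcent _ fun A => ?_
    -- The two maps agree on A and on BAB⁻¹, so Φ B and Φ₂ B conjugate Φ₂ A in the same way.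
    have hA : GeneralLinearGroup.det (B * (A : GL ι F) * B⁻¹) = 1 := by simp
    let C : SpecialLinearGroup ι F :=
      ⟨((B * (A : GL ι F) * B⁻¹ : GL ι F) : Matrix ι ι F), congrArg Units.val hA⟩
    have hC : (C : GL ι F) = B * (A : GL ι F) * B⁻¹ := by ext; rfl
    have := h C
    rw [hC] at this
    simp only [map_mul, map_inv, h A] at this
    rw [commute_iff_eq]
    have h2 := congrArg (fun z => (Φ₂ B)⁻¹ * z * Φ B) this
    simp only [mul_assoc, inv_mul_cancel, mul_one, inv_mul_cancel_left] at h2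
    rw [mul_assoc, h2]
  have hz' (x : Fˣ) : ∃ u : Fˣ, GeneralLinearGroup.scalar ι u = (Φ₂ (s x))⁻¹ * Φ (s x) := by
    have := hz (s x)
    rw [GeneralLinearGroup.center_eq_range_scalar] at this
    exact this
  choose lam hlam using hz'
  have hmul (x y : Fˣ) : lam (x * y) = lam x * lam y := by
    have hinj : Function.Injective (GeneralLinearGroup.scalar ι : Fˣ →* GL ι F) := by
      intro a b hab
      have := congrArg (fun M : GL ι F => (M : Matrix ι ι F) i₀ i₀) hab
      ext
      simpa using this
    apply hinj
    have hx : Φ (s x) = Φ₂ (s x) * GeneralLinearGroup.scalar ι (lam x) := by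
      rw [hlam, mul_inv_cancel_left]
    rw [map_mul, hlam, hlam y, map_mul, map_mul, map_mul, hx, _root_.mul_inv_rev]
    simp only [mul_assoc, inv_mul_cancel_left]
    rw [← mul_assoc, ← mul_assoc, GeneralLinearGroup.scalar_commute]
  refine ⟨MonoidHom.mk' lam hmul, fun A => ?_⟩
  set x := GeneralLinearGroup.det A with hx
  have hdet : GeneralLinearGroup.det ((s x)⁻¹ * A) = 1 := by simp [hs, hx]
  let C : SpecialLinearGroup ι F := ⟨(((s x)⁻¹ * A : GL ι F) : Matrix ι ι F), congrArg Units.val hdet⟩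
  have hC : A = s x * (C : GL ι F) := by
    have : (C : GL ι F) = (s x)⁻¹ * A := by ext; rfl
    rw [this, mul_inv_cancel_left]
  have hΦ : Φ A = GeneralLinearGroup.scalar ι (lam x) * Φ₂ A := by
    rw [hC, map_mul, map_mul, h C, ← mul_assoc, GeneralLinearGroup.scalar_commute, hlam,
      mul_inv_cancel_left]
  rw [hΦ]
  simp [Matrix.smul_eq_diagonal_mul]

end Extension

/-! ### Commuting involutions permuted by the symmetric group -/

section Signs

/-- Pascal's rule. This excludes sign patterns with between 2 and n - 2 minus signs, whose orbits
would supply too many independent vectors. -/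
lemma lt_choose {n k : ℕ} (hn : 4 ≤ n) (hk : 2 ≤ k) (hkn : k + 2 ≤ n) : n < n.choose k := by
  induction n, hn using Nat.le_induction generalizing k with
  | base =>
    obtain rfl : k = 2 := by omega
    decide
  | succ n hn ih =>
    obtain ⟨k, rfl⟩ : ∃ m, k = m + 1 := ⟨k - 1, by omega⟩
    rw [Nat.choose_succ_succ']
    rcases Nat.lt_or_ge k 2 with h | h
    · obtain rfl : k = 1 := by omega
      have := ih (k := 2) le_rfl (by omega)
      rw [Nat.choose_one_right]
      show n + 1 < n + n.choose 2
      omega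
    · rcases Nat.lt_or_ge (k + 2) n with h' | h'
      · have h1 := ih (k := k) h (by omega)
        have h2 := ih (k := k + 1) (by omega) (by omega)
        omega
      · obtain rfl : n = k + 2 := by omega
        have h1 := ih (k := k) h (by omega)
        have h2 : (k + 2).choose (k + 1) = k + 2 := by
          rw [Nat.choose_symm_of_eq_add (b := 1) (by omega), Nat.choose_one_right]
        omega

variable {ι : Type*} [Fintype ι] [DecidableEq ι] {F : Type*} [Field F]
  {S : ι → Matrix ι ι F}

/-- Commuting involutions, two of which are different, have a common eigenvector on which these
two differ by a sign. -/
lemma exists_common_eigenvector (hsq : ∀ i v, S i *ᵥ (S i *ᵥ v) = v)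
    (hcomm : ∀ i j v, S i *ᵥ (S j *ᵥ v) = S j *ᵥ (S i *ᵥ v)) {i₀ j₀ : ι} (hne : S i₀ ≠ S j₀) :
    ∃ v : ι → F, v ≠ 0 ∧ S i₀ *ᵥ (S j₀ *ᵥ v) = -v ∧ ∀ i, S i *ᵥ v = v ∨ S i *ᵥ v = -v := by
  have key : ∀ s : Finset ι, ∃ v : ι → F, v ≠ 0 ∧ S i₀ *ᵥ (S j₀ *ᵥ v) = -v ∧
      ∀ i ∈ s, S i *ᵥ v = v ∨ S i *ᵥ v = -v := by
    intro s
    induction s using Finset.induction_on with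
    | empty =>
      obtain ⟨w, hw⟩ : ∃ w : ι → F, S i₀ *ᵥ w ≠ S j₀ *ᵥ w := by
        by_contra! h
        exact hne (Matrix.mulVec_injective (funext h))
      refine ⟨S i₀ *ᵥ w - S j₀ *ᵥ w, sub_ne_zero.mpr hw, ?_, by simp⟩
      rw [Matrix.mulVec_sub, hsq, Matrix.mulVec_sub, hcomm i₀ j₀, hsq]
      abel
    | insert a s ha ih =>
      obtain ⟨v, hv, hv1, hv2⟩ := ih
      by_cases h : v + S a *ᵥ v = 0
      · refine ⟨v, hv, hv1, fun i hi => ?_⟩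
        rcases Finset.mem_insert.mp hi with rfl | hi
        · exact Or.inr (eq_neg_of_add_eq_zero_right h)
        · exact hv2 i hi
      -- The sum is fixed by `S a` and keeps the signs already arranged.
      · refine ⟨v + S a *ᵥ v, h, ?_, fun i hi => ?_⟩
        · rw [Matrix.mulVec_add, Matrix.mulVec_add, hv1, hcomm j₀ a, hcomm i₀ a, hv1,
            Matrix.mulVec_neg]
          abel
        · rcases Finset.mem_insert.mp hi with rfl | hi
          · left
            rw [Matrix.mulVec_add, hsq, add_comm]
          · rw [Matrix.mulVec_add, hcomm i a]
            rcases hv2 i hi with h2 | h2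
            · left; rw [h2]
            · right; rw [h2, Matrix.mulVec_neg]; abel
  obtain ⟨v, hv, hv1, hv2⟩ := key Finset.univ
  exact ⟨v, hv, hv1, fun i => hv2 i (Finset.mem_univ i)⟩

variable [CharZero F]

/-- Joint eigenvectors for different sign patterns are linearly independent. -/
lemma linearIndependent_of_signs {κ : Type*} (B : κ → Finset ι) (hB : Function.Injective B)
    (v : κ → ι → F) (hv : ∀ k, v k ≠ 0)
    (hS : ∀ k i, S i *ᵥ v k = if i ∈ B k then -v k else v k) : LinearIndependent F v := by
  let e := Fintype.equivFin ι
  -- Binary expansions encode subsets: the eigenvalue of `T` on `v k` is twice the number with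
  -- binary digits `B k`, so one operator separates all patterns.
  let T : Matrix ι ι F := ∑ i, (2 : F) ^ (e i : ℕ) • (1 - S i)
  let μ : κ → F := fun k => 2 * ∑ i ∈ B k, (2 : F) ^ (e i : ℕ)
  have hμ : Function.Injective μ := by
    intro k l h
    have h1 : ∑ i ∈ B k, (2 : F) ^ (e i : ℕ) = ∑ i ∈ B l, (2 : F) ^ (e i : ℕ) :=
      mul_left_cancel₀ two_ne_zero h
    let emb : ι ↪ ℕ := e.toEmbedding.trans Fin.valEmbedding
    have h2 : ∑ i ∈ (B k).map emb, 2 ^ i = ∑ i ∈ (B l).map emb, 2 ^ i := by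
      rw [Finset.sum_map, Finset.sum_map]
      exact_mod_cast h1
    exact hB (Finset.map_injective _ (Finset.geomSum_injective le_rfl h2))
  refine Module.End.eigenvectors_linearIndependent' (Matrix.toLin' T) μ hμ v fun k =>
    ⟨Module.End.mem_eigenspace_iff.mpr ?_, hv k⟩
  rw [Matrix.toLin'_apply, Matrix.sum_mulVec]
  have : ∀ i, ((2 : F) ^ (e i : ℕ) • (1 - S i)) *ᵥ v k =
      if i ∈ B k then (2 * (2 : F) ^ (e i : ℕ)) • v k else 0 := by
    intro i
    rw [Matrix.smul_mulVec, Matrix.sub_mulVec, Matrix.one_mulVec, hS]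
    split_ifs
    · module
    · simp
  simp only [this, μ]
  rw [Finset.sum_ite_mem, Finset.univ_inter, ← Finset.sum_smul, Finset.mul_sum]

/-- A family of commuting involutions permuted by the symmetric group is, up to a global sign, the
standard one in a suitable basis. -/
theorem exists_conj_signs (hcard : 3 ≤ Fintype.card ι) (hsq : ∀ i, S i * S i = 1)
    (hcomm : ∀ i j, S i * S j = S j * S i) (hne : ∀ i j, i ≠ j → S i ≠ S j)
    (P : Equiv.Perm ι → GL ι F)
    (hP : ∀ σ i, (P σ : Matrix ι ι F) * S i = S (σ i) * (P σ : Matrix ι ι F)) :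
    ∃ (R : GL ι F) (ε : F), ε ≠ 0 ∧ ∀ i, S i * (R : Matrix ι ι F) =
      (R : Matrix ι ι F) * (ε • diagonal fun k => if k = i then -1 else 1) := by
  obtain ⟨i₀, j₀, hij⟩ : ∃ i₀ j₀ : ι, i₀ ≠ j₀ :=
    Fintype.exists_pair_of_one_lt_card (by omega)
  obtain ⟨w, hw, hw1, hw2⟩ := exists_common_eigenvector
    (fun i v => by rw [Matrix.mulVec_mulVec, hsq, Matrix.one_mulVec])
    (fun i j v => by rw [Matrix.mulVec_mulVec, hcomm, ← Matrix.mulVec_mulVec]) (hne i₀ j₀ hij)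
  have hne' (u : ι → F) (hu : u ≠ 0) : -u ≠ u := fun h => hu (self_eq_neg.mp h.symm)
  classical
  let A : Finset ι := Finset.univ.filter fun i => S i *ᵥ w = -w
  have hA (i : ι) : S i *ᵥ w = if i ∈ A then -w else w := by
    by_cases h : S i *ᵥ w = -w
    · simp [A, h]
    · simp [A, (hw2 i).resolve_right h, (hne' w hw).symm]
  have hij' : ¬ (i₀ ∈ A ↔ j₀ ∈ A) := by
    intro h
    rw [hA j₀] at hw1
    by_cases h0 : i₀ ∈ A
    · rw [if_pos (h.mp h0), Matrix.mulVec_neg, hA, if_pos h0, neg_neg] at hw1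
      exact hne' w hw hw1.symm
    · rw [if_neg (fun h1 => h0 (h.mpr h1)), hA, if_neg h0] at hw1
      exact hne' w hw hw1.symm
  have horbit (B : Finset ι) (hB : B.card = A.card) :
      ∃ v : ι → F, v ≠ 0 ∧ ∀ i, S i *ᵥ v = if i ∈ B then -v else v := by
    let σ : Equiv.Perm ι := (Finset.equivOfCardEq hB.symm).extendSubtype
    have hσ (i : ι) : σ i ∈ B ↔ i ∈ A :=
      ⟨fun h => by
        by_contra h'
        exact Equiv.extendSubtype_not_mem (Finset.equivOfCardEq hB.symm) i h' h,
      fun h => Equiv.extendSubtype_mem (Finset.equivOfCardEq hB.symm) i h⟩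
    refine ⟨(P σ : Matrix ι ι F) *ᵥ w, fun h => hw ?_, fun i => ?_⟩
    · have := congrArg (fun z => ((P σ)⁻¹ : GL ι F).val *ᵥ z) h
      simpa only [Matrix.mulVec_mulVec, ← Units.val_mul, inv_mul_cancel, Units.val_one,
        Matrix.one_mulVec, Matrix.mulVec_zero] using this
    · obtain ⟨k, rfl⟩ := σ.surjective i
      rw [Matrix.mulVec_mulVec, ← hP, ← Matrix.mulVec_mulVec, hA]
      simp only [hσ]
      split_ifs
      · rw [Matrix.mulVec_neg]
      · rfl
  choose! v hv hSv using horbit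
  -- The vectors for all patterns of this size are independent in a space of dimension |ι|.
  have hcardA : (Fintype.card ι).choose A.card ≤ Fintype.card ι := by
    have hli := linearIndependent_of_signs (S := S)
      (fun B : {B : Finset ι // B.card = A.card} => B.1) Subtype.val_injective (fun B => v B.1)
      (fun B => hv B.1 B.2) (fun B i => hSv B.1 B.2 i)
    have := hli.fintype_card_le_finrank
    simpa using this
  have hA0 : A.card ≠ 0 := by
    intro h
    rw [Finset.card_eq_zero] at h
    simp [h] at hij'
  have hA1 : A.card ≠ Fintype.card ι := by
    intro h
    rw [Finset.card_eq_iff_eq_univ] at h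
    simp [h] at hij'
  have hAle : A.card ≤ Fintype.card ι := Finset.card_le_univ A
  have hcases : A.card = 1 ∨ A.card + 1 = Fintype.card ι := by
    by_contra! h
    exact absurd (lt_choose (n := Fintype.card ι) (k := A.card) (by omega) (by omega) (by omega))
      (by omega)
  -- `B i` is the set of minus signs of column i of the new basis: singletons give ε = 1, their
  -- complements ε = -1.
  have finish : ∀ (B : ι → Finset ι) (ε : F), ε ≠ 0 → Function.Injective B →
      (∀ i, (B i).card = A.card) →
      (∀ i j, (if j ∈ B i then (-1 : F) else 1) = ε * (if i = j then -1 else 1)) →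
      ∃ (R : GL ι F) (ε : F), ε ≠ 0 ∧ ∀ i, S i * (R : Matrix ι ι F) =
        (R : Matrix ι ι F) * (ε • diagonal fun k => if k = i then -1 else 1) := by
    intro B ε hε hB hBc hBε
    have hli := linearIndependent_of_signs (S := S) B hB (fun i => v (B i))
      (fun i => hv _ (hBc i)) (fun i j => hSv _ (hBc i) j)
    let R : Matrix ι ι F := of fun a i => v (B i) a
    have hR : IsUnit R := Matrix.linearIndependent_cols_iff_isUnit.mp hli
    refine ⟨hR.unit, ε, hε, fun j => ?_⟩
    ext a i
    rw [IsUnit.unit_spec, Matrix.mul_smul, Matrix.smul_apply, Matrix.mul_diagonal]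
    have h1 := congrFun (hSv (B i) (hBc i) j) a
    have h2 : (S j * R) a i = (S j *ᵥ v (B i)) a := rfl
    rw [h2, h1]
    have h3 := hBε i j
    have h4 : R a i = v (B i) a := rfl
    rw [h4]
    by_cases h : j ∈ B i
    · rw [if_pos h] at h3 ⊢
      rw [Pi.neg_apply, smul_eq_mul]
      linear_combination (v (B i) a) * h3
    · rw [if_neg h] at h3 ⊢
      rw [smul_eq_mul]
      linear_combination (v (B i) a) * h3
  rcases hcases with h | h
  · refine finish (fun i => {i}) 1 one_ne_zero Finset.singleton_injective (by simp [h]) ?_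
    intro i j
    simp [eq_comm]
  · refine finish (fun i => {i}ᶜ) (-1) (by simp)
      (compl_injective.comp Finset.singleton_injective) (fun i => ?_) ?_
    · rw [Finset.card_compl, Finset.card_singleton]
      omega
    · intro i j
      by_cases hij : i = j
      · simp [hij]
      · simp [hij, Ne.symm hij]

end Signs

/-! ### Transvections, permutation matrices and signs in GL(n) -/

section Elements

lemma exists_perm_apply_eq {ι : Type*} [DecidableEq ι] {i j k l : ι} (hij : i ≠ j) (hkl : k ≠ l) :
    ∃ σ : Equiv.Perm ι, σ i = k ∧ σ j = l := by
  refine ⟨Equiv.swap (Equiv.swap i k j) l * Equiv.swap i k, ?_, ?_⟩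
  · rw [Equiv.Perm.mul_apply, Equiv.swap_apply_left]
    refine Equiv.swap_apply_of_ne_of_ne (fun h => hij ?_) hkl
    apply (Equiv.swap i k).injective
    rw [← h, Equiv.swap_apply_left]
  · rw [Equiv.Perm.mul_apply, Equiv.swap_apply_left]

variable {ι : Type*} [Fintype ι] [DecidableEq ι] {F : Type*} [Field F]

/-- Transvections as elements of `GL(n, F)`. -/
def transGL {i j : ι} (h : i ≠ j) (t : F) : GL ι F :=
  ((SpecialLinearGroup.transvection h t : SpecialLinearGroup ι F) : GL ι F)

lemma coe_transGL {i j : ι} (h : i ≠ j) (t : F) :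
    (transGL h t : Matrix ι ι F) = 1 + single i j t := rfl

lemma transGL_apply_self {i j : ι} (h : i ≠ j) (t : F) : (transGL h t : Matrix ι ι F) i j = t := by
  simp [coe_transGL, h]

lemma transGL_injective {i j : ι} (h : i ≠ j) :
    Function.Injective (transGL h : F → GL ι F) := fun s t hst => by
  rw [← transGL_apply_self h s, hst, transGL_apply_self]

lemma transGL_add {i j : ι} (h : i ≠ j) (s t : F) :
    transGL h (s + t) = transGL h s * transGL h t := by
  rw [transGL, SpecialLinearGroup.transvection_add, map_mul]
  rfl

lemma transGL_zero {i j : ι} (h : i ≠ j) : transGL h (0 : F) = 1 := by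
  rw [transGL, SpecialLinearGroup.transvection_coeff_zero, map_one]

/-- The Steinberg commutator relation, which later links the constants and field endomorphisms at
different positions. -/
lemma transGL_mul_transGL {i j k : ι} (hij : i ≠ j) (hjk : j ≠ k) (hik : i ≠ k) (s t : F) :
    transGL hij s * transGL hjk t = transGL hik (s * t) * transGL hjk t * transGL hij s := by
  apply Units.ext
  simp only [Units.val_mul, coe_transGL, mul_add, add_mul, mul_one, one_mul,
    single_mul_single_same, single_mul_single_of_ne _ _ _ _ hjk.symm, single_mul_single_of_ne _ _ _ _ hik.symm]
  simp
  abel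

lemma diagGL_mul_transGL (d : ι → Fˣ) {i j : ι} (h : i ≠ j) (t : F) :
    diagGL d * transGL h t = transGL h (d i * t * ((d j)⁻¹ : Fˣ)) * diagGL d := by
  apply Units.ext
  simp only [Units.val_mul, coe_transGL, mul_add, add_mul, mul_one, one_mul]
  congr 1
  ext k l
  rw [coe_diagGL, Matrix.diagonal_mul, Matrix.mul_diagonal, single_apply, single_apply]
  split_ifs with hk
  · obtain ⟨rfl, rfl⟩ := hk
    simp
  · simp

/-- Permutation matrices as elements of `GL(n, F)`. -/
def permGL : Equiv.Perm ι →* GL ι F :=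
  (permMatrixHom (n := ι) (R := F)).toHomUnits

lemma permGL_mul_apply (σ : Equiv.Perm ι) (M : Matrix ι ι F) (k l : ι) :
    ((permGL σ : GL ι F) * M : Matrix ι ι F) (σ k) l = M k l := by
  change ((σ⁻¹).permMatrix F * M) (σ k) l = _
  rw [Equiv.Perm.permMatrix, PEquiv.toMatrix_toPEquiv_mul]
  simp

lemma mul_permGL_apply (σ : Equiv.Perm ι) (M : Matrix ι ι F) (k l : ι) :
    (M * (permGL σ : GL ι F) : Matrix ι ι F) k l = M k (σ l) := by
  change (M * (σ⁻¹).permMatrix F) k l = _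
  rw [Equiv.Perm.permMatrix, PEquiv.mul_toMatrix_toPEquiv]
  rfl

lemma permGL_mul_eq {σ : Equiv.Perm ι} {M N : GL ι F}
    (h : ∀ k l, (N : Matrix ι ι F) (σ k) (σ l) = (M : Matrix ι ι F) k l) :
    permGL σ * M = N * permGL σ := by
  ext k l
  obtain ⟨k, rfl⟩ := σ.surjective k
  rw [Units.val_mul, Units.val_mul, permGL_mul_apply, mul_permGL_apply, h]

lemma permGL_mul_transGL (σ : Equiv.Perm ι) {i j : ι} (h : i ≠ j) (t : F) :
    permGL σ * transGL h t = transGL (σ.injective.ne h) t * permGL σ := by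
  refine permGL_mul_eq fun k l => ?_
  simp [coe_transGL, Matrix.one_apply, single_apply]

/-- The diagonal matrix with entry `-1` at `i` and `1` elsewhere. -/
def signGL (i : ι) : GL ι F := diagGL (Pi.mulSingle i (-1))

lemma coe_signGL (i : ι) :
    ((signGL i : GL ι F) : Matrix ι ι F) = diagonal fun k => if k = i then -1 else 1 := by
  rw [signGL, coe_diagGL]
  congr 1
  ext k
  by_cases h : k = i
  · subst h; simp
  · simp [h]

lemma permGL_mul_signGL (σ : Equiv.Perm ι) (i : ι) :
    permGL σ * (signGL i : GL ι F) = signGL (σ i) * permGL σ := by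
  refine permGL_mul_eq fun k l => ?_
  simp [coe_signGL, Matrix.diagonal_apply]

lemma signGL_mul_self (i : ι) : signGL i * signGL i = (1 : GL ι F) := by
  rw [signGL, ← map_mul, ← Pi.mulSingle_mul]
  simp

lemma signGL_mul_comm (i j : ι) : signGL i * signGL j = (signGL j * signGL i : GL ι F) := by
  rw [signGL, signGL, ← map_mul, ← map_mul, mul_comm]

/-- A homomorphism that is nontrivial on `SL(n, F)` kills no transvection. -/
lemma map_transGL_ne_one [Nontrivial ι] {G : Type*} [Group G] (Φ : GL ι F →* G)
    (hΦ : ∃ A : SpecialLinearGroup ι F, Φ (A : GL ι F) ≠ 1) {i j : ι} (h : i ≠ j) {t : F}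
    (ht : t ≠ 0) : Φ (transGL h t) ≠ 1 := by
  intro h1
  obtain ⟨A, hA⟩ := hΦ
  apply hA
  -- Diagonal conjugation reaches every nonzero parameter and permutations reach every position, so
  -- killing one transvection kills SL.
  have hconj {x y z : GL ι F} (hxy : x * y = z * x) (hy : Φ y = 1) : Φ z = 1 := by
    have := congrArg Φ hxy
    rw [map_mul, map_mul, hy, mul_one] at this
    exact mul_eq_right.mp this.symm
  have hij (s : F) : Φ (transGL h s) = 1 := by
    by_cases hs : s = 0
    · rw [hs, transGL_zero, map_one]
    · have h2 := hconj (diagGL_mul_transGL (Pi.mulSingle i (Units.mk0 (s / t) (div_ne_zero hs ht)))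
        h t) h1
      simpa [h.symm, ht] using h2
  have : Φ.comp (SpecialLinearGroup.toGL (n := ι) (R := F)) = 1 := by
    refine eq_of_eq_transvection fun k l hkl s => ?_
    obtain ⟨σ, rfl, rfl⟩ := exists_perm_apply_eq h hkl
    exact hconj (permGL_mul_transGL σ h s) (hij s)
  exact DFunLike.congr_fun this A

end Elements

/-! ### Recognizing standard form on transvections -/

section StandardForm

variable {n : ℕ} {F : Type*} [Field F]

lemma coe_entrywiseMap (φ : F →+* F) (A : GL (Fin n) F) :
    (entrywiseMap φ A : Matrix (Fin n) (Fin n) F) = (A : Matrix (Fin n) (Fin n) F).map φ := rfl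

lemma entrywiseMap_transGL (φ : F →+* F) {i j : Fin n} (h : i ≠ j) (t : F) :
    entrywiseMap φ (transGL h t) = transGL h (φ t) := by
  apply Units.ext
  rw [coe_entrywiseMap, coe_transGL, coe_transGL]
  ext k l
  simp [Matrix.one_apply, single_apply, apply_ite φ]

lemma coe_adjTransposeMap (A : GL (Fin n) F) : (adjTransposeMap A : Matrix (Fin n) (Fin n) F) =
    (A : Matrix (Fin n) (Fin n) F).adjugateᵀ := rfl

/-- `adjTransposeMap` as a homomorphism. -/
noncomputable def adjTransposeHom : GL (Fin n) F →* GL (Fin n) F :=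
  MonoidHom.mk' adjTransposeMap fun A B => by
    apply Units.ext
    rw [Units.val_mul, coe_adjTransposeMap, coe_adjTransposeMap, coe_adjTransposeMap,
      Units.val_mul, adjugate_mul_distrib, transpose_mul]

/-- `conjMap R ∘ entrywiseMap φ` as a homomorphism. -/
def conjEntrywiseHom (R : GL (Fin n) F) (φ : F →+* F) : GL (Fin n) F →* GL (Fin n) F :=
  MonoidHom.mk' (conjMap R ∘ entrywiseMap φ) fun A B => by
    simp only [Function.comp, conjMap, entrywiseMap, map_mul]
    group

lemma adjTransposeHom_transGL {i j : Fin n} (h : i ≠ j) (t : F) :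
    adjTransposeHom (transGL h t) = transGL h.symm (-t) := by
  apply Units.ext
  change ((SpecialLinearGroup.transvection h t : SpecialLinearGroup (Fin n) F) :
    Matrix (Fin n) (Fin n) F).adjugateᵀ = _
  rw [← Matrix.SpecialLinearGroup.coe_inv, SpecialLinearGroup.transvection_inv, coe_transGL,
    SpecialLinearGroup.transvection_coe, transpose_add, transpose_one, transpose_single]

/-- Since φ fixes 1, the matrix RMR⁻¹ commutes with every off-diagonal matrix unit and is therefore
scalar. -/
lemma mem_center_of_commute_conjEntrywiseHom (R : GL (Fin n) F) (φ : F →+* F) (M : GL (Fin n) F)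
    (h : ∀ (i j : Fin n) (hij : i ≠ j), Commute M (conjEntrywiseHom R φ (transGL hij 1))) :
    M ∈ Subgroup.center (GL (Fin n) F) := by
  have h2 : R * M * R⁻¹ ∈ Subgroup.center (GL (Fin n) F) := by
    rw [GeneralLinearGroup.mem_center_iff_val_mem_range_scalar]
    refine mem_range_scalar_of_commute_single fun i j hij => ?_
    have h3 : conjEntrywiseHom R φ (transGL hij 1) = R⁻¹ * transGL hij 1 * R := by
      change R⁻¹ * entrywiseMap φ (transGL hij 1) * R = _
      rw [entrywiseMap_transGL, map_one]
    have h4 : Commute (R * M * R⁻¹) (transGL hij 1) := by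
      have h5 := (h i j hij).eq
      rw [h3] at h5
      have h6 := congrArg (fun x => R * x * R⁻¹) h5
      simp only [mul_assoc, mul_inv_cancel, mul_one, mul_inv_cancel_left] at h6
      rw [commute_iff_eq]
      simpa only [mul_assoc] using h6
    have h7 := congrArg Units.val h4.eq
    rw [Units.val_mul (R * M * R⁻¹), Units.val_mul (transGL hij 1), coe_transGL, mul_add, add_mul,
      mul_one, one_mul] at h7
    exact (add_left_cancel h7).symm
  have h4 := Subgroup.Normal.conj_mem inferInstance _ h2 R⁻¹
  simpa [mul_assoc] using h4

lemma hasStandardForm_of_eq_on_sl [Nontrivial (Fin n)] (Φ Φ₂ : GL (Fin n) F →* GL (Fin n) F)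
    (hΦ₂ : IsStandardComposition (Φ₂ : GL (Fin n) F → GL (Fin n) F))
    (h : ∀ (i j : Fin n) (hij : i ≠ j) (t : F), Φ (transGL hij t) = Φ₂ (transGL hij t))
    (hcent : ∀ M : GL (Fin n) F, (∀ (i j : Fin n) (hij : i ≠ j) (t : F),
      Commute M (Φ₂ (transGL hij t))) → M ∈ Subgroup.center (GL (Fin n) F)) :
    HasStandardForm Φ := by
  have hSL : Φ.comp (SpecialLinearGroup.toGL (n := Fin n) (R := F)) =
      Φ₂.comp (SpecialLinearGroup.toGL (n := Fin n) (R := F)) :=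
    eq_of_eq_transvection fun i j hij t => h i j hij t
  obtain ⟨lam, hlam⟩ := exists_eq_smul_of_eq_on_sl Φ Φ₂ (fun A => DFunLike.congr_fun hSL A)
    (fun M hM => hcent M fun i j hij t => hM _)
  -- `conjMap 1` is the identity, so `lam` is applied to det A itself.
  refine ⟨lam, conjMap 1, Φ₂, .conj 1, hΦ₂, fun A => ?_⟩
  rw [hlam, conjMap, inv_one, one_mul, mul_one]

theorem hasStandardForm_of_eq_conjEntrywise [Nontrivial (Fin n)] (Φ : GL (Fin n) F →* GL (Fin n) F)
    (R : GL (Fin n) F) (φ : F →+* F) (h : ∀ (i j : Fin n) (hij : i ≠ j) (t : F),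
      Φ (transGL hij t) = conjEntrywiseHom R φ (transGL hij t)) : HasStandardForm Φ :=
  hasStandardForm_of_eq_on_sl Φ (conjEntrywiseHom R φ)
    (IsStandardComposition.comp (.conj R) (.entrywise φ) :
      IsStandardComposition (conjMap R ∘ entrywiseMap φ)) h
    fun M hM => mem_center_of_commute_conjEntrywiseHom R φ M fun i j hij => hM i j hij 1

/-- On SL, A ↦ (A*)ᵗ is the inverse transpose, an involution; composing with it twice recovers `Φ`
there. -/
theorem hasStandardForm_of_comp_adjTranspose_eq [Nontrivial (Fin n)]
    (Φ : GL (Fin n) F →* GL (Fin n) F) (R : GL (Fin n) F) (φ : F →+* F)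
    (h : ∀ (i j : Fin n) (hij : i ≠ j) (t : F),
      Φ (adjTransposeHom (transGL hij t)) = conjEntrywiseHom R φ (transGL hij t)) :
    HasStandardForm Φ := by
  refine hasStandardForm_of_eq_on_sl Φ ((conjEntrywiseHom R φ).comp adjTransposeHom)
    (IsStandardComposition.comp (.comp (.conj R) (.entrywise φ)) .adjTranspose :
      IsStandardComposition ((conjMap R ∘ entrywiseMap φ) ∘ adjTransposeMap)) (fun i j hij t => ?_)
    fun M hM => mem_center_of_commute_conjEntrywiseHom R φ M fun i j hij => ?_
  · rw [MonoidHom.comp_apply, adjTransposeHom_transGL, ← h, adjTransposeHom_transGL, neg_neg]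
  · have := hM j i hij.symm (-1)
    rwa [MonoidHom.comp_apply, adjTransposeHom_transGL, neg_neg] at this

end StandardForm

/-! ### SL(2) blocks under a homomorphism that preserves signs -/

section Block

variable {ι : Type*} [Fintype ι] [DecidableEq ι] {F : Type*} [Field F]

lemma commute_blockHom_signGL {i j k : ι} (h : i ≠ j) (hki : k ≠ i) (hkj : k ≠ j)
    (A : SpecialLinearGroup (Fin 2) F) :
    Commute ((blockHom h A : SpecialLinearGroup ι F) : GL ι F) (signGL k) := by
  rw [commute_iff_eq]
  ext a b
  rw [Units.val_mul, Units.val_mul, coe_signGL, Matrix.diagonal_mul, Matrix.mul_diagonal]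
  change (blockHom h A : Matrix ι ι F) a b * _ = _ * (blockHom h A : Matrix ι ι F) a b
  rw [blockHom_apply, Matrix.one_apply]
  by_cases ha : a = k <;> by_cases hb : b = k
  · simp [ha, hb]
  · subst ha; simp [Ne.symm hb, hki, hkj]
  · subst hb; simp [ha, hki, hkj]
  · simp [ha, hb]

lemma commute_blockHom_diag2_signGL {i j : ι} (k : ι) (h : i ≠ j) {c : F} (hc : c ≠ 0) :
    Commute ((blockHom h (SpecialLinearGroup.diag2 c hc) : SpecialLinearGroup ι F) : GL ι F)
      (signGL k) := by
  rw [commute_iff_eq, blockHom_diag2]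
  apply Units.ext
  rw [Units.val_mul, Units.val_mul, coe_signGL]
  change (SpecialLinearGroup.diag2n h c hc : Matrix ι ι F) * _ =
    _ * (SpecialLinearGroup.diag2n h c hc : Matrix ι ι F)
  rw [SpecialLinearGroup.diag2n_coe, Matrix.diagonal_mul_diagonal, Matrix.diagonal_mul_diagonal]
  simp only [mul_comm]

variable [CharZero F] {Φ : GL ι F →* GL ι F} {ε : F}

/-- The image commutes with a diagonal matrix whose k-th entry differs from all others, so it splits
off coordinate k. -/
lemma map_apply_eq_zero_of_commute (hε : ε ≠ 0)
    (hsign : ∀ i, (Φ (signGL i) : Matrix ι ι F) = ε • diagonal fun k => if k = i then -1 else 1)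
    {x : GL ι F} {k l : ι} (hx : Commute x (signGL k)) (hkl : l ≠ k) :
    (Φ x : Matrix ι ι F) k l = 0 ∧ (Φ x : Matrix ι ι F) l k = 0 := by
  have h := congrArg Units.val (hx.map Φ).eq
  rw [Units.val_mul, Units.val_mul, hsign, Matrix.mul_smul, Matrix.smul_mul] at h
  have h' := smul_right_injective _ hε h
  have h1 := congrFun (congrFun h' k) l
  have h2 := congrFun (congrFun h' l) k
  simp only [Matrix.diagonal_mul, Matrix.mul_diagonal, if_neg hkl, if_true] at h1 h2
  constructor
  · have : (2 : F) * (Φ x : Matrix ι ι F) k l = 0 := by linear_combination h1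
    simpa using this
  · have : (2 : F) * (Φ x : Matrix ι ι F) l k = 0 := by linear_combination -h2
    simpa using this

/-- A block commutes with the signs outside it, so its image is a 2 × 2 block plus diagonal entries.
Each such entry is a character of SL(2, F), hence 1, and the 2 × 2 block determines the image. -/
lemma exists_sl_two_hom (hε : ε ≠ 0)
    (hsign : ∀ i, (Φ (signGL i) : Matrix ι ι F) = ε • diagonal fun k => if k = i then -1 else 1)
    {i j : ι} (h : i ≠ j) :
    ∃ ρ : SpecialLinearGroup (Fin 2) F →* Matrix (Fin 2) (Fin 2) F,
      (∀ A, ρ A = (Φ ((blockHom h A : SpecialLinearGroup ι F) : GL ι F) : Matrix ι ι F).submatrix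
        ![i, j] ![i, j]) ∧
      ∀ A B : SpecialLinearGroup (Fin 2) F, ρ A = (B : Matrix (Fin 2) (Fin 2) F) →
        Φ ((blockHom h A : SpecialLinearGroup ι F) : GL ι F) =
          ((blockHom h B : SpecialLinearGroup ι F) : GL ι F) := by
  let N : SpecialLinearGroup (Fin 2) F →* Matrix ι ι F :=
    (Units.coeHom _).comp (Φ.comp ((SpecialLinearGroup.toGL (n := ι) (R := F)).comp (blockHom h)))
  have hN (A : SpecialLinearGroup (Fin 2) F) {k l : ι} (hki : k ≠ i) (hkj : k ≠ j) (hlk : l ≠ k) :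
      N A k l = 0 ∧ N A l k = 0 :=
    map_apply_eq_zero_of_commute hε hsign (commute_blockHom_signGL h hki hkj A) hlk
  have hsum (A B : SpecialLinearGroup (Fin 2) F) {k l : ι} (hk : k = i ∨ k = j) :
      N (A * B) k l = N A k i * N B i l + N A k j * N B j l := by
    rw [map_mul, Matrix.mul_apply]
    refine Fintype.sum_eq_add i j h fun x hx => ?_
    rw [(hN A hx.1 hx.2 (l := k) (by rintro rfl; tauto)).2, zero_mul]
  let ρ : SpecialLinearGroup (Fin 2) F →* Matrix (Fin 2) (Fin 2) F :=
    { toFun := fun A => (N A).submatrix ![i, j] ![i, j]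
      map_one' := by
        ext a b
        rw [map_one]
        fin_cases a <;> fin_cases b <;> simp [h, h.symm, Matrix.one_apply]
      map_mul' := fun A B => by
        ext a b
        rw [Matrix.submatrix_apply, hsum A B (by fin_cases a <;> simp), Matrix.mul_apply,
          Fin.sum_univ_two]
        rfl }
  have hdiag (k : ι) (hki : k ≠ i) (hkj : k ≠ j) (A : SpecialLinearGroup (Fin 2) F) :
      N A k k = 1 := by
    let χ : SpecialLinearGroup (Fin 2) F →* F :=
      { toFun := fun A => N A k k
        map_one' := by rw [map_one, Matrix.one_apply_eq]
        map_mul' := fun A B => by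
          rw [map_mul, Matrix.mul_apply]
          refine Fintype.sum_eq_single k fun x hx => ?_
          rw [(hN A hki hkj hx).1, zero_mul] }
    exact monoidHom_sl_two_eq_one χ A
  refine ⟨ρ, fun A => rfl, fun A B hAB => ?_⟩
  ext k l
  change N A k l = (blockHom h B : Matrix ι ι F) k l
  have hρ (a b : Fin 2) : N A (![i, j] a) (![i, j] b) = B a b := congrFun (congrFun hAB a) b
  rw [blockHom_apply, Matrix.one_apply]
  by_cases hki : k = i
  · subst hki
    by_cases hlk : l = k
    · subst hlk; simpa using hρ 0 0
    · by_cases hlj : l = j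
      · subst hlj; simpa [h, h.symm] using hρ 0 1
      · simp [hlk, Ne.symm hlk, hlj, (hN A hlk hlj (Ne.symm hlk)).2]
  · by_cases hkj : k = j
    · subst hkj
      by_cases hlk : l = k
      · subst hlk; simpa [h.symm] using hρ 1 1
      · by_cases hli : l = i
        · subst hli; simpa [h, h.symm] using hρ 1 0
        · simp [hlk, Ne.symm hlk, hli, (hN A hli hlk (Ne.symm hlk)).2]
    · by_cases hlk : l = k
      · subst hlk; simp [hki, hkj, hdiag l hki hkj]
      · simp [hki, hkj, Ne.symm hlk, (hN A hki hkj hlk).1]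

/-- A homomorphism `SL(2, F) → M₂(F)` that does not kill `upper 1` and preserves a diagonal matrix
is given on unipotents by a field endomorphism, possibly after transposition. -/
lemma upper_lower_of_diag2 (ρ : SpecialLinearGroup (Fin 2) F →* Matrix (Fin 2) (Fin 2) F)
    (h : ρ (upper 1) ≠ 1) (h01 : ρ (SpecialLinearGroup.diag2 2 two_ne_zero) 0 1 = 0)
    (h10 : ρ (SpecialLinearGroup.diag2 2 two_ne_zero) 1 0 = 0) :
    ∃ (φ : F →+* F) (c : F), c ≠ 0 ∧
      ((∀ t, ρ (upper t) = (upper (c * φ t) : Matrix (Fin 2) (Fin 2) F) ∧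
        ρ (lower t) = (lower (c⁻¹ * φ t) : Matrix (Fin 2) (Fin 2) F)) ∨
      (∀ t, ρ (upper t) = (lower (c * φ t) : Matrix (Fin 2) (Fin 2) F) ∧
        ρ (lower t) = (upper (c⁻¹ * φ t) : Matrix (Fin 2) (Fin 2) F))) := by
  obtain ⟨R, φ, hR⟩ := exists_conjHom_eq_map ρ h
  have hRρ (A : SpecialLinearGroup (Fin 2) F) : (R : Matrix (Fin 2) (Fin 2) F) * ρ A =
      (A : Matrix (Fin 2) (Fin 2) F).map φ * (R : Matrix (Fin 2) (Fin 2) F) := by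
    rw [← hR]
    simp [conjHom, Matrix.mul_assoc]
  have hinj {X Y : Matrix (Fin 2) (Fin 2) F} (hXY : (R : Matrix (Fin 2) (Fin 2) F) * X =
      (R : Matrix (Fin 2) (Fin 2) F) * Y) : X = Y := by
    exact R.isUnit.mul_left_cancel hXY
  have hdet : (R : Matrix (Fin 2) (Fin 2) F).det ≠ 0 := GeneralLinearGroup.det_ne_zero R
  rw [det_fin_two] at hdet
  obtain ⟨p, q, r, s, hpq⟩ : ∃ p q r s, (R : Matrix (Fin 2) (Fin 2) F) = !![p, q; r, s] :=
    ⟨_, _, _, _, eta_fin_two _⟩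
  have hd := hRρ (SpecialLinearGroup.diag2 2 two_ne_zero)
  obtain ⟨x, y, hxy⟩ : ∃ x y, ρ (SpecialLinearGroup.diag2 2 two_ne_zero) = !![x, 0; 0, y] :=
    ⟨_, _, by rw [← h01]; nth_rewrite 2 [h01]; rw [← h10]; exact eta_fin_two _⟩
  rw [hxy, hpq, SpecialLinearGroup.diag2_coe'] at hd
  rw [hpq] at hdet
  have e00 := congrFun (congrFun hd 0) 0
  have e01 := congrFun (congrFun hd 0) 1
  have e10 := congrFun (congrFun hd 1) 0
  have e11 := congrFun (congrFun hd 1) 1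
  simp [Matrix.mul_apply, Fin.sum_univ_two] at e00 e01 e10 e11 hdet
  rw [map_ofNat φ 2] at e00 e01 e10 e11
  -- The columns of `R` are eigenvectors of diag(2, 2⁻¹). As its eigenvalues differ, `R` is diagonal
  -- or antidiagonal, which gives the two alternatives.
  have hhalf : (2 : F) ≠ 2⁻¹ := by
    intro h
    have : (3 : F) = 0 := by linear_combination 2 * h - mul_inv_cancel₀ (two_ne_zero (α := F))
    norm_num at this
  by_cases hp : p = 0
  · subst hp
    have hr : r ≠ 0 := by rintro rfl; simp at hdet
    have hq : q ≠ 0 := by rintro rfl; simp at hdet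
    have hs : s = 0 := by
      by_contra hs
      have hy2 : y = 2 := by apply mul_left_cancel₀ hq; linear_combination e01
      have hy : y = 2⁻¹ := by apply mul_left_cancel₀ hs; linear_combination e11
      exact hhalf (hy2.symm.trans hy)
    subst hs
    refine ⟨φ, r / q, div_ne_zero hr hq, Or.inr fun t => ⟨hinj ?_, hinj ?_⟩⟩
    · rw [hRρ, hpq, coe_upper, coe_lower]
      ext a b
      fin_cases a <;> fin_cases b <;> simp [Matrix.mul_apply, Fin.sum_univ_two, field]
    · rw [hRρ, hpq, coe_upper, coe_lower]
      ext a b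
      fin_cases a <;> fin_cases b <;> simp [Matrix.mul_apply, Fin.sum_univ_two, field]
  · have hx : x = 2 := by apply mul_left_cancel₀ hp; linear_combination e00
    have hr : r = 0 := by
      by_contra hr
      have hx2 : x = 2⁻¹ := by apply mul_left_cancel₀ hr; linear_combination e10
      exact hhalf (hx.symm.trans hx2)
    subst hr
    have hs : s ≠ 0 := by rintro rfl; simp at hdet
    have hq : q = 0 := by
      by_contra hq
      have hy2 : y = 2 := by apply mul_left_cancel₀ hq; linear_combination e01
      have hy : y = 2⁻¹ := by apply mul_left_cancel₀ hs; linear_combination e11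
      exact hhalf (hy2.symm.trans hy)
    subst hq
    refine ⟨φ, s / p, div_ne_zero hs hp, Or.inl fun t => ⟨hinj ?_, hinj ?_⟩⟩
    · rw [hRρ, hpq, coe_upper, coe_upper]
      ext a b
      fin_cases a <;> fin_cases b <;> simp [Matrix.mul_apply, Fin.sum_univ_two, field]
    · rw [hRρ, hpq, coe_lower, coe_lower]
      ext a b
      fin_cases a <;> fin_cases b <;> simp [Matrix.mul_apply, Fin.sum_univ_two, field]

end Block

/-! ### Positions of transvections under a sign-preserving homomorphism -/

section SignNormalized

variable {ι : Type*} [Fintype ι] [DecidableEq ι] {F : Type*} [Field F]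

/-- `Φ` sends the transvections at `(i, j)` and `(j, i)` to transvections at the same places. -/
def IsStraightAt (Φ : GL ι F →* GL ι F) {i j : ι} (h : i ≠ j) : Prop :=
  ∃ (φ : F →+* F) (c : F), c ≠ 0 ∧ ∀ t, Φ (transGL h t) = transGL h (c * φ t) ∧
    Φ (transGL h.symm t) = transGL h.symm (c⁻¹ * φ t)

/-- `Φ` interchanges the transvections at `(i, j)` and `(j, i)`. -/
def IsTransposedAt (Φ : GL ι F →* GL ι F) {i j : ι} (h : i ≠ j) : Prop :=
  ∃ (φ : F →+* F) (c : F), c ≠ 0 ∧ ∀ t, Φ (transGL h t) = transGL h.symm (c * φ t) ∧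
    Φ (transGL h.symm t) = transGL h (c⁻¹ * φ t)

/-- A homomorphism sending transvections to transvections in the same position is, on
transvections, induced by a field endomorphism and a diagonal conjugation. -/
theorem exists_diag_of_isStraightAt (hcard : 3 ≤ Fintype.card ι) {Φ : GL ι F →* GL ι F}
    (hΦ : ∀ (i j : ι) (h : i ≠ j), IsStraightAt Φ h) :
    ∃ (d : ι → Fˣ) (φ : F →+* F), ∀ (i j : ι) (h : i ≠ j) (t : F),
      Φ (transGL h t) = diagGL d * transGL h (φ t) * (diagGL d)⁻¹ := by
  choose φ c hc hφ using hΦ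
  -- At s = t = 1 this is a cocycle identity for c; at t = 1 it then identifies the endomorphisms
  -- along a row.
  have hmul {i j k : ι} (hij : i ≠ j) (hjk : j ≠ k) (hik : i ≠ k) (s t : F) :
      (c i j hij * φ i j hij s) * (c j k hjk * φ j k hjk t) =
        c i k hik * φ i k hik (s * t) := by
    have h1 := congrArg Φ (transGL_mul_transGL hij hjk hik s t)
    simp only [map_mul, (hφ _ _ _ _).1] at h1
    rw [transGL_mul_transGL hij hjk hik] at h1
    have h2 := transGL_injective hik (mul_right_cancel (mul_right_cancel h1))
    rw [h2, map_mul]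
  have hc3 {i j k : ι} (hij : i ≠ j) (hjk : j ≠ k) (hik : i ≠ k) :
      c i j hij * c j k hjk = c i k hik := by
    simpa using hmul hij hjk hik 1 1
  have hcsymm {i j : ι} (hij : i ≠ j) : c i j hij = (c j i hij.symm)⁻¹ := by
    have h1 := (hφ i j hij 1).1
    rw [(hφ j i hij.symm 1).2] at h1
    simpa using (transGL_injective hij h1).symm
  have hφsymm {i j : ι} (hij : i ≠ j) : φ i j hij = φ j i hij.symm := by
    ext t
    have h1 := (hφ i j hij t).1
    rw [(hφ j i hij.symm t).2] at h1
    have h2 := transGL_injective hij h1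
    rw [← hcsymm hij] at h2
    exact (mul_left_cancel₀ (hc i j hij) h2).symm
  have hrow {i j k : ι} (hij : i ≠ j) (hjk : j ≠ k) (hik : i ≠ k) :
      φ i j hij = φ i k hik := by
    ext t
    have h1 := hmul hij hjk hik t 1
    rw [map_one, mul_one, mul_one, ← hc3 hij hjk hik] at h1
    apply mul_left_cancel₀ (mul_ne_zero (hc i j hij) (hc j k hjk))
    linear_combination h1
  have hcol {i j k : ι} (hij : i ≠ j) (hjk : j ≠ k) (hik : i ≠ k) :
      φ j k hjk = φ i k hik := by
    rw [hφsymm hjk, hφsymm hik]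
    exact hrow hjk.symm hij.symm hik.symm
  obtain ⟨p, q, hpq⟩ : ∃ p q : ι, p ≠ q := Fintype.exists_pair_of_one_lt_card (by omega)
  have hpφ {j : ι} (h : p ≠ j) : φ p j h = φ p q hpq := by
    by_cases hjq : j = q
    · subst hjq; rfl
    · exact hrow h hjq hpq
  have hall {i j : ι} (h : i ≠ j) : φ i j h = φ p q hpq := by
    by_cases hip : i = p
    · subst hip; exact hpφ h
    · by_cases hjp : j = p
      · subst hjp; rw [hφsymm h]; exact hpφ h.symm
      · rw [← hcol (Ne.symm hip) h (Ne.symm hjp) |>.symm]; exact hpφ (Ne.symm hjp)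
  -- The cocycle c is the coboundary of i ↦ c i p, completed by 1 at the base index p.
  refine ⟨fun i => if h : i = p then 1 else Units.mk0 (c i p h) (hc i p h), φ p q hpq,
    fun i j h t => ?_⟩
  rw [diagGL_mul_transGL, mul_inv_cancel_right, (hφ i j h t).1, hall h]
  congr 1
  by_cases hip : i = p
  · subst hip
    simp [h.symm, hcsymm h, mul_comm]
  · by_cases hjp : j = p
    · subst hjp
      simp [hip]
    · have := hc3 h hjp hip
      simp only [hip, hjp, dif_neg, not_false_iff, Units.val_mk0, ← this, Units.val_inv_eq_inv_val]
      field_simp [hc j p hjp]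

variable [CharZero F] {Φ : GL ι F →* GL ι F} {ε : F}

/-- The block element diag(2, 2⁻¹) commutes with all signs, so its image is diagonal and
`upper_lower_of_diag2` applies. -/
lemma isStraightAt_or_isTransposedAt [Nontrivial ι] (hε : ε ≠ 0)
    (hsign : ∀ i, (Φ (signGL i) : Matrix ι ι F) = ε • diagonal fun k => if k = i then -1 else 1)
    (hΦ : ∃ A : SpecialLinearGroup ι F, Φ (A : GL ι F) ≠ 1) {i j : ι} (h : i ≠ j) :
    IsStraightAt Φ h ∨ IsTransposedAt Φ h := by
  obtain ⟨ρ, hρ, hρB⟩ := exists_sl_two_hom hε hsign h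
  have hu (t : F) : ((blockHom h (upper t) : SpecialLinearGroup ι F) : GL ι F) = transGL h t := by
    rw [blockHom_upper]; rfl
  have hl (t : F) : ((blockHom h (lower t) : SpecialLinearGroup ι F) : GL ι F) =
      transGL h.symm t := by
    rw [blockHom_lower]; rfl
  have hdiag (k l : ι) (hlk : l ≠ k) :=
    map_apply_eq_zero_of_commute hε hsign (commute_blockHom_diag2_signGL k h
      (two_ne_zero (α := F))) hlk
  obtain ⟨φ, c, hc, hcase⟩ := upper_lower_of_diag2 ρ
    (fun h1 => by
      have h2 := hρB (upper 1) 1 (by rw [h1]; rfl)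
      rw [hu, map_one, map_one] at h2
      exact map_transGL_ne_one Φ hΦ h one_ne_zero h2)
    (by rw [hρ]; exact (hdiag i j h.symm).1) (by rw [hρ]; exact (hdiag j i h).1)
  rcases hcase with hcase | hcase
  · refine Or.inl ⟨φ, c, hc, fun t => ⟨?_, ?_⟩⟩
    · rw [← hu, ← hu, hρB _ _ (hcase t).1]
    · rw [← hl, ← hl, hρB _ _ (hcase t).2]
  · refine Or.inr ⟨φ, c, hc, fun t => ⟨?_, ?_⟩⟩
    · rw [← hu, ← hl, hρB _ _ (hcase t).1]
    · rw [← hu, ← hl, hρB _ _ (hcase t).2]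

/-- Permutation matrices are sent to monomial matrices. -/
lemma map_permGL_apply_eq_zero (hε : ε ≠ 0)
    (hsign : ∀ i, (Φ (signGL i) : Matrix ι ι F) = ε • diagonal fun k => if k = i then -1 else 1)
    (σ : Equiv.Perm ι) {k l : ι} (hkl : k ≠ σ l) : (Φ (permGL σ) : Matrix ι ι F) k l = 0 := by
  have h := congrArg (fun x => (Φ x : Matrix ι ι F)) (permGL_mul_signGL (F := F) σ l)
  simp only [map_mul, Units.val_mul, hsign, Matrix.mul_smul, Matrix.smul_mul] at h
  have h' := congrFun (congrFun (smul_right_injective _ hε h) k) l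
  simp only [Matrix.diagonal_mul, Matrix.mul_diagonal, if_neg hkl, if_true] at h'
  have : (2 : F) * (Φ (permGL σ) : Matrix ι ι F) k l = 0 := by linear_combination -h'
  simpa using this

lemma map_permGL_apply_ne_zero (hε : ε ≠ 0)
    (hsign : ∀ i, (Φ (signGL i) : Matrix ι ι F) = ε • diagonal fun k => if k = i then -1 else 1)
    (σ : Equiv.Perm ι) (i : ι) : (Φ (permGL σ) : Matrix ι ι F) (σ i) i ≠ 0 := by
  intro h0
  have h1 : ((Φ (permGL σ))⁻¹ * Φ (permGL σ) : GL ι F).val i i = 1 := by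
    rw [inv_mul_cancel, Units.val_one, Matrix.one_apply_eq]
  rw [Units.val_mul, Matrix.mul_apply, Finset.sum_eq_zero] at h1
  · exact zero_ne_one h1
  · intro k _
    by_cases hk : k = σ i
    · rw [hk, h0, mul_zero]
    · rw [map_permGL_apply_eq_zero hε hsign σ hk, mul_zero]

lemma map_transGL_apply_eq_zero_of_perm (hε : ε ≠ 0)
    (hsign : ∀ i, (Φ (signGL i) : Matrix ι ι F) = ε • diagonal fun k => if k = i then -1 else 1)
    (σ : Equiv.Perm ι) {i j : ι} (h : i ≠ j) (t : F)
    (h0 : (Φ (transGL h t) : Matrix ι ι F) i j = 0) :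
    (Φ (transGL (σ.injective.ne h) t) : Matrix ι ι F) (σ i) (σ j) = 0 := by
  have h1 := congrArg (fun x => (Φ x : Matrix ι ι F)) (permGL_mul_transGL σ h t)
  simp only [map_mul, Units.val_mul] at h1
  have h2 := congrFun (congrFun h1 (σ i)) j
  rw [Matrix.mul_apply, Matrix.mul_apply, Finset.sum_eq_single i, Finset.sum_eq_single (σ j), h0,
    mul_zero] at h2
  · exact (mul_eq_zero.mp h2.symm).resolve_right (map_permGL_apply_ne_zero hε hsign σ j)
  · intro k _ hk
    rw [map_permGL_apply_eq_zero hε hsign σ hk, mul_zero]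
  · simp
  · intro k _ hk
    rw [map_permGL_apply_eq_zero hε hsign σ (σ.injective.ne (Ne.symm hk)), zero_mul]
  · simp

/-- The behaviour on transvections is the same at all positions. -/
theorem forall_isStraightAt_or_forall_isTransposedAt [Nontrivial ι] (hε : ε ≠ 0)
    (hsign : ∀ i, (Φ (signGL i) : Matrix ι ι F) = ε • diagonal fun k => if k = i then -1 else 1)
    (hΦ : ∃ A : SpecialLinearGroup ι F, Φ (A : GL ι F) ≠ 1) :
    (∀ (i j : ι) (h : i ≠ j), IsStraightAt Φ h) ∨ (∀ (i j : ι) (h : i ≠ j), IsTransposedAt Φ h) := by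
  have hor {i j : ι} (h : i ≠ j) := isStraightAt_or_isTransposedAt hε hsign hΦ h
  -- The (i, j) entry tells the two cases apart. Its vanishing is carried to any other position by
  -- permutations, whose images are monomial with the same support.
  have hstraight {i j : ι} {h : i ≠ j} (hs : IsStraightAt Φ h) :
      (Φ (transGL h 1) : Matrix ι ι F) i j ≠ 0 := by
    obtain ⟨φ, c, hc, hs⟩ := hs
    rw [(hs 1).1, transGL_apply_self]
    simpa using hc
  have htransposed {i j : ι} {h : i ≠ j} (hs : IsTransposedAt Φ h) :
      (Φ (transGL h 1) : Matrix ι ι F) i j = 0 := by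
    obtain ⟨φ, c, hc, hs⟩ := hs
    rw [(hs 1).1, coe_transGL]
    simp [h, h.symm]
  by_cases hex : ∃ (i j : ι) (h : i ≠ j), IsTransposedAt Φ h
  · right
    obtain ⟨i, j, h, ht⟩ := hex
    intro k l hkl
    obtain ⟨σ, rfl, rfl⟩ := exists_perm_apply_eq h hkl
    refine (hor hkl).resolve_left fun hs => hstraight hs ?_
    exact map_transGL_apply_eq_zero_of_perm hε hsign σ h 1 (htransposed ht)
  · left
    push Not at hex
    exact fun i j h => (hor h).resolve_right (hex i j h)

end SignNormalized

/-! ### The classification on GL(n, F) -/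

section Main

variable {n : ℕ} {F : Type*} [Field F] [CharZero F]

/-- For k outside {i, j}, `signGL i` inverts the transvection at (i, k) while `signGL j` fixes it.
Equal images would kill the transvection with parameter 2. -/
lemma map_signGL_ne {ι : Type*} [Fintype ι] [DecidableEq ι] (hcard : 3 ≤ Fintype.card ι)
    (Φ : GL ι F →* GL ι F) (hΦ : ∃ A : SpecialLinearGroup ι F, Φ (A : GL ι F) ≠ 1) {i j : ι}
    (hij : i ≠ j) : Φ (signGL i) ≠ Φ (signGL j) := by
  intro h
  have : Nontrivial ι := ⟨i, j, hij⟩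
  obtain ⟨k, hk⟩ : ∃ k, k ∉ ({i, j} : Finset ι) := by
    by_contra! hall
    have := Finset.card_le_card (fun x _ => hall x : Finset.univ ⊆ ({i, j} : Finset ι))
    rw [Finset.card_univ] at this
    have := Finset.card_le_two (a := i) (b := j)
    omega
  simp only [Finset.mem_insert, Finset.mem_singleton, not_or] at hk
  have hik : i ≠ k := Ne.symm hk.1
  have h1 : signGL i * transGL hik (1 : F) = transGL hik (-1) * signGL i := by
    rw [signGL, diagGL_mul_transGL]
    congr 2
    simp [hk.1]
  have h2 : signGL j * transGL hik (1 : F) = transGL hik 1 * signGL j := by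
    rw [signGL, diagGL_mul_transGL]
    congr 2
    simp [hij, hk.2]
  have h1' := congrArg Φ h1
  have h2' := congrArg Φ h2
  rw [map_mul, map_mul, h] at h1'
  rw [map_mul, map_mul, h1'] at h2'
  have h3 := mul_right_cancel h2'
  apply map_transGL_ne_one Φ hΦ hik (t := (1 : F) + 1) (by norm_num)
  rw [transGL_add, map_mul]
  nth_rewrite 1 [← h3]
  rw [← map_mul, ← transGL_add, neg_add_cancel, transGL_zero, map_one]

theorem hasStandardForm_of_three_le (hn : 3 ≤ n) (Φ : GL (Fin n) F →* GL (Fin n) F)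
    (hΦ : ∃ A : SpecialLinearGroup (Fin n) F, Φ (A : GL (Fin n) F) ≠ 1) : HasStandardForm Φ := by
  have : Nontrivial (Fin n) := Fin.nontrivial_iff_two_le.mpr (by omega)
  have hcard : 3 ≤ Fintype.card (Fin n) := by simpa
  obtain ⟨R, ε, hε, hR⟩ := exists_conj_signs (F := F)
    (S := fun i => (Φ (signGL i) : Matrix (Fin n) (Fin n) F)) hcard
    (fun i => by rw [← Units.val_mul, ← map_mul, signGL_mul_self, map_one, Units.val_one])
    (fun i j => by rw [← Units.val_mul, ← map_mul, signGL_mul_comm, map_mul, Units.val_mul])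
    (fun i j hij h => map_signGL_ne hcard Φ hΦ hij (Units.ext h))
    (fun σ => Φ (permGL σ))
    (fun σ i => by
      rw [← Units.val_mul, ← map_mul, permGL_mul_signGL, map_mul, Units.val_mul])
  let Φ' : GL (Fin n) F →* GL (Fin n) F := (MulAut.conj R⁻¹).toMonoidHom.comp Φ
  have hΦ' (x : GL (Fin n) F) : Φ' x = R⁻¹ * Φ x * R := by
    simp [Φ']
  have hsign (i : Fin n) : (Φ' (signGL i) : Matrix (Fin n) (Fin n) F) =
      ε • diagonal fun k => if k = i then -1 else 1 := by
    rw [hΦ', mul_assoc, Units.val_mul, Units.val_mul, hR, ← Matrix.mul_assoc, ← Units.val_mul,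
      inv_mul_cancel, Units.val_one, Matrix.one_mul]
  have hnt : ∃ A : SpecialLinearGroup (Fin n) F, Φ' (A : GL (Fin n) F) ≠ 1 := by
    obtain ⟨A, hA⟩ := hΦ
    refine ⟨A, fun h => hA ?_⟩
    rw [hΦ', mul_assoc, inv_mul_eq_one] at h
    exact mul_eq_right.mp h.symm
  have hconj (d : Fin n → Fˣ) (φ : F →+* F) {i j : Fin n} (h : i ≠ j) (t : F) (x : GL (Fin n) F)
      (hx : Φ' x = diagGL d * transGL h (φ t) * (diagGL d)⁻¹) :
      Φ x = conjEntrywiseHom (R * diagGL d)⁻¹ φ (transGL h t) := by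
    change _ = (R * diagGL d)⁻¹⁻¹ * entrywiseMap φ (transGL h t) * (R * diagGL d)⁻¹
    rw [entrywiseMap_transGL, inv_inv, _root_.mul_inv_rev]
    rw [hΦ'] at hx
    calc Φ x = R * (R⁻¹ * Φ x * R) * R⁻¹ := by group
      _ = _ := by rw [hx]; group
  rcases forall_isStraightAt_or_forall_isTransposedAt hε hsign hnt with hs | ht
  · obtain ⟨d, φ, hd⟩ := exists_diag_of_isStraightAt hcard hs
    exact hasStandardForm_of_eq_conjEntrywise Φ (R * diagGL d)⁻¹ φ
      fun i j h t => hconj d φ h t _ (hd i j h t)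
  -- Precomposing with the inverse transpose makes every position straight, the constant c becoming
  -- -c⁻¹.
  · have hs : ∀ (i j : Fin n) (h : i ≠ j), IsStraightAt (Φ'.comp adjTransposeHom) h := by
      intro i j h
      obtain ⟨φ, c, hc, hφ⟩ := ht i j h
      refine ⟨φ, -c⁻¹, neg_ne_zero.mpr (inv_ne_zero hc), fun t => ⟨?_, ?_⟩⟩
      · rw [MonoidHom.comp_apply, adjTransposeHom_transGL, (hφ _).2]
        simp
      · rw [MonoidHom.comp_apply, adjTransposeHom_transGL, (hφ _).1]
        simp [inv_neg]
    obtain ⟨d, φ, hd⟩ := exists_diag_of_isStraightAt hcard hs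
    exact hasStandardForm_of_comp_adjTranspose_eq Φ (R * diagGL d)⁻¹ φ
      fun i j h t => hconj d φ h t _ (hd i j h t)

/-- The inverse transpose is not needed here, being inner on SL(2, F). -/
theorem hasStandardForm_two (Φ : GL (Fin 2) F →* GL (Fin 2) F)
    (hΦ : ∃ A : SpecialLinearGroup (Fin 2) F, Φ (A : GL (Fin 2) F) ≠ 1) : HasStandardForm Φ := by
  let ρ : SpecialLinearGroup (Fin 2) F →* Matrix (Fin 2) (Fin 2) F :=
    (Units.coeHom _).comp (Φ.comp (SpecialLinearGroup.toGL (n := Fin 2) (R := F)))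
  obtain ⟨R, φ, hR⟩ := exists_conjHom_eq_map ρ fun h =>
    map_transGL_ne_one Φ hΦ zero_ne_one one_ne_zero (Units.ext h)
  refine hasStandardForm_of_eq_conjEntrywise Φ R φ fun i j h t => ?_
  have h1 : R * Φ (transGL h t) * R⁻¹ = entrywiseMap φ (transGL h t) :=
    Units.ext (hR (SpecialLinearGroup.transvection h t))
  change _ = R⁻¹ * entrywiseMap φ (transGL h t) * R
  rw [← h1]
  group

/-- Every multiplicative self-map of `GL(n, F)` that is nontrivial on `SL(n, F)` has standard
form. -/
theorem hasStandardForm_of_not_isTrivialGL (Φ : GL (Fin n) F → GL (Fin n) F)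
    (hmul : IsMultiplicative Φ) (hΦ : ¬ IsTrivialGL Φ) : HasStandardForm Φ := by
  obtain ⟨f, rfl⟩ : ∃ f : GL (Fin n) F →* GL (Fin n) F, ⇑f = Φ :=
    ⟨MonoidHom.mk' Φ hmul, rfl⟩
  have hf : ∃ A : SpecialLinearGroup (Fin n) F, f (A : GL (Fin n) F) ≠ 1 := by
    by_contra! h
    refine hΦ fun A hA => ?_
    let B : SpecialLinearGroup (Fin n) F := ⟨(A : Matrix (Fin n) (Fin n) F), hA⟩
    have : A = (B : GL (Fin n) F) := by ext; rfl
    rw [this]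
    exact h B
  -- SL(0, F) and SL(1, F) are trivial groups.
  have hn : n ≠ 0 ∧ n ≠ 1 := by
    constructor <;> rintro rfl <;> obtain ⟨A, hA⟩ := hf <;> apply hA <;>
      rw [Subsingleton.elim A 1, map_one, map_one]
  rcases Nat.lt_or_ge n 3 with h | h
  · obtain rfl : n = 2 := by omega
    exact hasStandardForm_two f hf
  · exact hasStandardForm_of_three_le h f hf

/-! ### Degenerate maps and extension by zero -/

/-- The extension of a map on `GL(n, F)` by zero on singular matrices. -/
noncomputable def extendByZero {F : Type*} [Field F] (Φ : GL (Fin n) F → GL (Fin n) F)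
    (A : Matrix (Fin n) (Fin n) F) : Matrix (Fin n) (Fin n) F :=
  open Classical in
  if h : A.det = 0 then 0
  else (Φ (GeneralLinearGroup.mkOfDetNeZero A h) : Matrix (Fin n) (Fin n) F)

lemma extendByZero_of_det_eq_zero {F : Type*} [Field F] (Φ : GL (Fin n) F → GL (Fin n) F)
    {A : Matrix (Fin n) (Fin n) F} (h : A.det = 0) : extendByZero Φ A = 0 :=
  dif_pos h

lemma extendByZero_coe {F : Type*} [Field F] (Φ : GL (Fin n) F → GL (Fin n) F)
    (A : GL (Fin n) F) :
    extendByZero Φ (A : Matrix (Fin n) (Fin n) F) = (Φ A : Matrix (Fin n) (Fin n) F) := by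
  rw [extendByZero, dif_neg (GeneralLinearGroup.det_ne_zero A)]
  congr 2
  exact Units.ext rfl

lemma exists_coe_eq {F : Type*} [Field F] {A : Matrix (Fin n) (Fin n) F} (h : A.det ≠ 0) :
    ∃ B : GL (Fin n) F, (B : Matrix (Fin n) (Fin n) F) = A :=
  ⟨GeneralLinearGroup.mkOfDetNeZero A h, rfl⟩

lemma isDegenerate_extendByZero {F : Type*} [Field F] (Φ : GL (Fin n) F → GL (Fin n) F)
    (hmul : IsMultiplicative Φ) (hΦ : ¬ IsTrivialGL Φ) : IsDegenerate (extendByZero Φ) where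
  mul A B := by
    by_cases hA : A.det = 0
    · rw [extendByZero_of_det_eq_zero Φ hA, zero_mul,
        extendByZero_of_det_eq_zero Φ (by rw [det_mul, hA, zero_mul])]
    by_cases hB : B.det = 0
    · rw [extendByZero_of_det_eq_zero Φ hB, mul_zero,
        extendByZero_of_det_eq_zero Φ (by rw [det_mul, hB, mul_zero])]
    obtain ⟨A, rfl⟩ := exists_coe_eq hA
    obtain ⟨B, rfl⟩ := exists_coe_eq hB
    rw [← Units.val_mul, extendByZero_coe, extendByZero_coe, extendByZero_coe, hmul, Units.val_mul]
  one := by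
    rw [← Units.val_one, extendByZero_coe]
    exact congrArg Units.val (map_one (MonoidHom.mk' Φ hmul))
  nontrivial h := hΦ fun A hA => Units.ext (by rw [← extendByZero_coe, h _ hA, Units.val_one])
  singular A hA := extendByZero_of_det_eq_zero Φ hA

/-- A unital multiplicative map sends units to units. -/
lemma IsDegenerate.exists_restriction {F : Type*} [Field F]
    {Ψ : Matrix (Fin n) (Fin n) F → Matrix (Fin n) (Fin n) F} (hΨ : IsDegenerate Ψ) :
    ∃ Φ : GL (Fin n) F → GL (Fin n) F, IsMultiplicative Φ ∧ ¬ IsTrivialGL Φ ∧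
      ∀ A : GL (Fin n) F,
        Ψ (A : Matrix (Fin n) (Fin n) F) = (Φ A : Matrix (Fin n) (Fin n) F) := by
  let f : Matrix (Fin n) (Fin n) F →* Matrix (Fin n) (Fin n) F :=
    { toFun := Ψ, map_one' := hΨ.one, map_mul' := hΨ.mul }
  refine ⟨Units.map f, map_mul _, fun h => hΨ.nontrivial fun A hA => ?_, fun A => rfl⟩
  obtain ⟨B, rfl⟩ := exists_coe_eq (A := A) (by rw [hA]; exact one_ne_zero)
  exact congrArg Units.val (h B hA)

end Main

end MultMaps

theorem mainTheorem1 (n : ℕ) (F : Type*) [Field F] [CharZero F] :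
    (∀ Φ : Matrix.GeneralLinearGroup (Fin n) F → Matrix.GeneralLinearGroup (Fin n) F,
      MultMaps.IsMultiplicative Φ → ¬ MultMaps.IsTrivialGL Φ → MultMaps.HasStandardForm Φ) ∧
    (∀ Ψ : Matrix (Fin n) (Fin n) F → Matrix (Fin n) (Fin n) F,
      MultMaps.IsDegenerate Ψ →
        ∃ Φ : Matrix.GeneralLinearGroup (Fin n) F → Matrix.GeneralLinearGroup (Fin n) F,
          MultMaps.IsMultiplicative Φ ∧ ¬ MultMaps.IsTrivialGL Φ ∧ MultMaps.HasStandardForm Φ ∧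
          ∀ A : Matrix.GeneralLinearGroup (Fin n) F,
            Ψ (A : Matrix (Fin n) (Fin n) F) = (Φ A : Matrix (Fin n) (Fin n) F)) ∧
    (∀ Φ : Matrix.GeneralLinearGroup (Fin n) F → Matrix.GeneralLinearGroup (Fin n) F,
      MultMaps.IsMultiplicative Φ → ¬ MultMaps.IsTrivialGL Φ →
        ∃! Ψ : Matrix (Fin n) (Fin n) F → Matrix (Fin n) (Fin n) F,
          MultMaps.IsDegenerate Ψ ∧
          ∀ A : Matrix.GeneralLinearGroup (Fin n) F,
            Ψ (A : Matrix (Fin n) (Fin n) F) = (Φ A : Matrix (Fin n) (Fin n) F)) := by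
  refine ⟨fun Φ => MultMaps.hasStandardForm_of_not_isTrivialGL Φ, fun Ψ hΨ => ?_,
    fun Φ hmul hΦ => ?_⟩
  · obtain ⟨Φ, hmul, hnt, hres⟩ := hΨ.exists_restriction
    exact ⟨Φ, hmul, hnt, MultMaps.hasStandardForm_of_not_isTrivialGL Φ hmul hnt, hres⟩
  · refine ⟨MultMaps.extendByZero Φ, ⟨MultMaps.isDegenerate_extendByZero Φ hmul hΦ,
      MultMaps.extendByZero_coe Φ⟩, fun Ψ hΨ => funext fun A => ?_⟩
    by_cases hA : A.det = 0
    · rw [hΨ.1.singular A hA, MultMaps.extendByZero_of_det_eq_zero Φ hA]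
    · obtain ⟨A, rfl⟩ := MultMaps.exists_coe_eq hA
      rw [hΨ.2, MultMaps.extendByZero_coe]
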